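/- **Proposition 4.1.** Let $q\in\mathbb{C}$ with $0<|q|<1$. Put $(x)_\infty=\prod_{j\ge 0}(1-xq^j)$ and, for $k\in\mathbb{Z}$, $(x)_k=(x)_\infty/(xq^k)_\infty$, i.e. $(x)_k=\prod_{j=0}^{k-1}(1-xq^j)$ for $k\ge 0$ and $(x)_{-n}=\prod_{j=1}^{n}(1-xq^{-j})^{-1}$ for $n\ge 1$ (so that $1/(q^{1+m})_k=0$ for $k<-m$); write $(x_1,\dots,x_r)_k=(x_1)_k\cdots(x_r)_k$ and $${}_8\psi_8\!\left[\begin{matrix}A_1,\dots,A_8\\ B_1,\dots,B_8\end{matrix};q,z\right]=\sum_{k\in\mathbb{Z}}\frac{(A_1,\dots,A_8)_k}{(B_1,\dots,B_8)_k}z^k .$$ Let $m\ge 0$ be an integer, let $a,\alpha,\rho_1,\rho_2,\mu_1,\mu_2$ be nonzero complex numbers with $|\alpha/a|<1$ and $|aq/\mu_1\mu_2|<1$, and put $\lambda:=\alpha\mu_1\mu_2/aq$. Let $\sqrt a$ and $\sqrt\lambda$ be any square roots. Assume that all terms of the two series below are well defined (no lower parameter is of the form $q^{-j}$ with $j\ge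 0$, and no upper parameter is of the form $q^{j}$ with $1\le j\le m$), and that $(\lambda q)_\infty\ne 0$ and $(q/\lambda)_m\neq 0$. Then both series converge absolutely, and $${}_8\psi_8\!\left[\begin{matrix}q\sqrt{a},-q\sqrt{a},\rho_1,\rho_2,\mu_1,\mu_2,aq^{-m},a^3q^{2+m}/\alpha\rho_1\rho_2\mu_1\mu_2\\ \sqrt{a},-\sqrt{a},aq/\rho_1,aq/\rho_2,aq/\mu_1,aq/\mu_2,q^{1+m},\alpha\rho_1\rho_2\mu_1\mu_2q^{-m}/qa^2\end{matrix};q,\frac{\alpha}{a}\right]$$ $$=\frac{(aq)_\infty(\lambda q/\mu_1)_\infty(\lambda q/\mu_2)_\infty(aq/\mu_1\mu_2)_\infty}{(\alpha/a)_\infty(aq/\mu_1)_\infty(aq/\mu_2)_\infty(\lambda q)_\infty}\cdot\frac{(q/a,\,aq/\lambda\rho_1,\,aq/\lambda\rho_2,\,aq/\rho_1\rho_2)_m}{(q/\rho_1,\,q/\rho_2,\,q/\lambda,\,qa^2/\lambda\rho_1\rho_2)_m}$$ $$\times\,{}_8\psi_8\!\left[\begin{matrix}q\sqrt{\lambda},-q\sqrt{\lambda},\mu_1,\mu_2,\lambda\rho_1/a,\lambda\rho_2/a,\lambda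 q^{-m},aq^{1+m}/\rho_1\rho_2\\ \sqrt{\lambda},-\sqrt{\lambda},\lambda q/\mu_1,\lambda q/\mu_2,aq/\rho_1,aq/\rho_2,q^{1+m},\lambda\rho_1\rho_2q^{-m}/a\end{matrix};q,\frac{\alpha}{\lambda}\right].$$ -/

import Mathlib

noncomputable section

/-- The infinite `q`-shifted factorial `(a; q)_∞ = ∏_{j ≥ 0} (1 - a q^j)`. -/
def qPochInf (q a : ℂ) : ℂ := ∏' j : ℕ, (1 - a * q ^ j)

/-- The `q`-shifted factorial `(a; q)_k` for an integer `k`, that is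
`(a; q)_k = ∏_{0 ≤ j < k} (1 - a q^j)` for `k ≥ 0` and
`(a; q)_{-n} = 1 / ∏_{1 ≤ j ≤ n} (1 - a q^{-j})` for `n ≥ 1`.
It equals `(a; q)_∞ / (a q^k; q)_∞` whenever `(a q^k; q)_∞ ≠ 0`
(see `qPoch_eq_div`); the finite products also give the intended value where that quotient is
`0 / 0`.

At a pole (`k = -n < 0` and `a = q^j` with `1 ≤ j ≤ n`) Lean's `1 / 0 = 0` gives
`(a; q)_k = 0`, and therefore `1 / (a; q)_k = 0`, which is the standard convention
for a reciprocal (see `inv_qPoch_neg`). -/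
def qPoch (q a : ℂ) : ℤ → ℂ
  | Int.ofNat n => ∏ j ∈ Finset.range n, (1 - a * q ^ j)
  | Int.negSucc n => (∏ j ∈ Finset.range (n + 1), (1 - a / q ^ (j + 1)))⁻¹

/-- The reciprocal `1 / (a; q)_{-n}` is the polynomial `∏_{1 ≤ j ≤ n} (1 - a q^{-j})` in `a`,
for all `a`. -/
theorem inv_qPoch_neg (q a : ℂ) (n : ℕ) :
    (qPoch q a (-(n : ℤ)))⁻¹ = ∏ j ∈ Finset.range n, (1 - a / q ^ (j + 1)) := by
  cases n with
  | zero => simp [qPoch]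
  | succ n =>
    have h : (-((n + 1 : ℕ) : ℤ)) = Int.negSucc n := rfl
    rw [h]
    simp [qPoch]

theorem qPochInf_split (q a : ℂ) (hq1 : ‖q‖ < 1) (n : ℕ) :
    qPochInf q a = (∏ j ∈ Finset.range n, (1 - a * q ^ j)) * qPochInf q (a * q ^ n) := by
  have hm : Multipliable (fun j : ℕ => 1 - a * q ^ (j + n)) := by
    have hs : Summable (fun j : ℕ => ‖-(a * q ^ n * q ^ j)‖) := by
      simp only [norm_neg, norm_mul, norm_pow]
      exact (summable_geometric_of_lt_one (norm_nonneg q) hq1).mul_left _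
    have := multipliable_one_add_of_summable hs
    refine this.congr fun j => ?_
    rw [pow_add]; ring
  have h := hm.prod_mul_tprod_nat_mul' (f := fun j : ℕ => 1 - a * q ^ j)
  unfold qPochInf
  rw [← h]
  congr 1
  refine tprod_congr fun j => ?_
  rw [pow_add]; ring

/-- `(a; q)_k = (a; q)_∞ / (a q^k; q)_∞` for every integer `k` for which the denominator is not
zero. -/
theorem qPoch_eq_div (q a : ℂ) (hq0 : q ≠ 0) (hq1 : ‖q‖ < 1) (k : ℤ)
    (h : qPochInf q (a * q ^ k) ≠ 0) :
    qPoch q a k = qPochInf q a / qPochInf q (a * q ^ k) := by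
  cases k with
  | ofNat n =>
    have h' : qPochInf q (a * q ^ n) ≠ 0 := by simpa using h
    rw [eq_div_iff h]
    simpa [qPoch] using (qPochInf_split q a hq1 n).symm
  | negSucc n =>
    have e : a * q ^ (Int.negSucc n) * q ^ (n + 1) = a := by
      rw [zpow_negSucc, mul_assoc, inv_mul_cancel₀ (pow_ne_zero _ hq0), mul_one]
    have hs := qPochInf_split q (a * q ^ (Int.negSucc n)) hq1 (n + 1)
    rw [e] at hs
    have hp : ∏ j ∈ Finset.range (n + 1), (1 - a * q ^ (Int.negSucc n) * q ^ j)
        = ∏ j ∈ Finset.range (n + 1), (1 - a / q ^ (j + 1)) := by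
      rw [← Finset.prod_range_reflect]
      refine Finset.prod_congr rfl fun j hj => ?_
      have hj' : j ≤ n := Nat.lt_succ_iff.mp (Finset.mem_range.mp hj)
      have e2 : n + 1 = (n + 1 - 1 - j) + (j + 1) := by omega
      rw [zpow_negSucc, div_eq_mul_inv, mul_assoc]
      congr 2
      have : q ^ (n + 1) = q ^ (n + 1 - 1 - j) * q ^ (j + 1) := by rw [← pow_add, ← e2]
      rw [this]
      field_simp
    rw [hp] at hs
    rw [hs] at h
    have h1 := left_ne_zero_of_mul h
    have h2 := right_ne_zero_of_mul h
    rw [hs]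
    simp only [qPoch]
    field_simp

/-- The `k`-th term `(A_1, …, A_s)_k / (B_1, …, B_s)_k · z^k` of a bilateral basic hypergeometric
series. -/
def bilateralTerm {s : ℕ} (A B : Fin s → ℂ) (q z : ℂ) (k : ℤ) : ℂ :=
  (∏ i, qPoch q (A i) k) / (∏ i, qPoch q (B i) k) * z ^ k

/-- The bilateral basic hypergeometric series `_sψ_s [A_1, …, A_s; B_1, …, B_s; q, z]`. -/
def bilateralPsi {s : ℕ} (A B : Fin s → ℂ) (q z : ℂ) : ℂ :=
  ∑' k : ℤ, bilateralTerm A B q z k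

/-- The terms of index `k ≥ -m` of the bilateral series are well defined: no denominator
`(B_i)_k` vanishes (which can only happen for `k ≥ 1`), and no numerator `(A_i)_k` has a pole
(which can only happen for `k ≤ -1`). If `q^{1+m}` is among the `B_i`, these are all the terms,
since `1 / (q^{1+m})_k = 0` for `k < -m`. -/
def BilateralDefined {s : ℕ} (m : ℕ) (A B : Fin s → ℂ) (q : ℂ) : Prop :=
  (∀ i, ∀ j : ℕ, B i * q ^ j ≠ 1) ∧ (∀ i, ∀ j : ℕ, 1 ≤ j → j ≤ m → A i ≠ q ^ j)

end

/-! The lower parameter `q^(1+m)` kills all terms with `k < -m`, so both bilateral series are really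
unilateral. With `k = n - m`, each is a constant times a very-well-poised `₈φ₇`: the base becomes `a
q^(-2m)` (resp. `λ q^(-2m)`), the other parameters acquire a factor `q^(-m)`, and the pair `a
q^(-m)`, `q^(1+m)` turns into the new base and `q`. The last upper parameter is exactly the one that
makes the shifted parameters satisfy the balance condition `λ b c d = q a²` of Bailey's
nonterminating transformation, `tsum_eightCoeff`, with `μ₁`, `μ₂` as the two parameters that it
leaves alone. Comparing constants then gives the claim (`shiftConst_mul_qPochInf`,
`prefactor_identity`).

Bailey's transformation comes from a double series, `baileyDouble`. Its antidiagonal sums are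
evaluated by Jackson's terminating sum (`bailey_expansion`) and give the left side; its row sums are
`₆φ₅` series (`tsum_sixCoeff`) and give the right side. The `₆φ₅` sum is the limit `n → ∞` of
Jackson's sum, by dominated convergence. Jackson's sum (`sum_jacksonTerm`) is proved by induction on
`n`: the sum at `(n+1, x)` minus `jacksonFactor` times the sum at `(n, x q)` telescopes to zero.

All unilateral series are multiplied through by the infinite products of their lower parameters `B =
a q / b, …`, which replaces `1 / (B)_n` by `(B q^n)_∞`. The identities between them then need no
nonvanishing conditions on these parameters. -/

noncomputable section

open Filter Topology

/-! ### Finite `q`-shifted factorials -/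

/-- The finite `q`-shifted factorial `(a; q)_n` for a natural number `n`. -/
def qFin (q a : ℂ) (n : ℕ) : ℂ := ∏ j ∈ Finset.range n, (1 - a * q ^ j)

theorem qPoch_natCast (q a : ℂ) (n : ℕ) : qPoch q a (n : ℤ) = qFin q a n := rfl

@[simp] theorem qFin_zero (q a : ℂ) : qFin q a 0 = 1 := by simp [qFin]

theorem qFin_succ (q a : ℂ) (n : ℕ) : qFin q a (n + 1) = qFin q a n * (1 - a * q ^ n) := by
  simp [qFin, Finset.prod_range_succ]

theorem qFin_succ_left (q a : ℂ) (n : ℕ) : qFin q a (n + 1) = (1 - a) * qFin q (a * q) n := by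
  simp only [qFin, Finset.prod_range_succ']
  rw [mul_comm]
  congr 1
  · simp
  · refine Finset.prod_congr rfl fun j _ => ?_
    ring

theorem qFin_add (q a : ℂ) (m n : ℕ) :
    qFin q a (m + n) = qFin q a m * qFin q (a * q ^ m) n := by
  simp only [qFin, Finset.prod_range_add]
  congr 1
  refine Finset.prod_congr rfl fun j _ => ?_
  ring

theorem qFin_ne_zero {q a : ℂ} {n : ℕ} (h : ∀ j < n, a * q ^ j ≠ 1) : qFin q a n ≠ 0 :=
  Finset.prod_ne_zero_iff.2 fun j hj => sub_ne_zero.2 (h j (Finset.mem_range.1 hj)).symm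

theorem pow_succ_ne_one {q : ℂ} (hq1 : ‖q‖ < 1) (n : ℕ) : q ^ (n + 1) ≠ 1 := by
  intro h
  have h1 : ‖q‖ ^ (n + 1) = 1 := by rw [← norm_pow, h, norm_one]
  exact absurd h1 (pow_lt_one₀ (norm_nonneg q) hq1 n.succ_ne_zero).ne

theorem qFin_self_ne_zero {q : ℂ} (hq1 : ‖q‖ < 1) (n : ℕ) : qFin q q n ≠ 0 :=
  qFin_ne_zero fun j _ => by
    rw [← pow_succ']
    exact pow_succ_ne_one hq1 j

theorem qPochInf_eq_qFin_mul {q : ℂ} (hq1 : ‖q‖ < 1) (a : ℂ) (n : ℕ) :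
    qPochInf q a = qFin q a n * qPochInf q (a * q ^ n) :=
  qPochInf_split q a hq1 n

theorem qPochInf_eq_one_sub_mul {q : ℂ} (hq1 : ‖q‖ < 1) (a : ℂ) :
    qPochInf q a = (1 - a) * qPochInf q (a * q) := by
  have := qPochInf_eq_qFin_mul hq1 a 1
  simpa [qFin] using this

/-! ### Jackson's terminating sum in polynomial form -/

/-- The `k`-th term of the terminating very-well-poised sum with base `a = b c d x`, cleared of the
lower parameters `a q / b`, `a q / c`, `a q / d`. -/
def jacksonTerm (q b c d x : ℂ) (n k : ℕ) : ℂ :=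
  (1 - b * c * d * x * q ^ (2 * k)) *
    (qFin q (b * c * d * x) k * qFin q b k * qFin q c k * qFin q d k) *
    (qPochInf q (c * d * x * q ^ (k + 1)) * qPochInf q (b * d * x * q ^ (k + 1)) *
      qPochInf q (b * c * x * q ^ (k + 1))) * (x * q) ^ k *
    (qFin q (b * c * d * x * x * q ^ (n + 1)) k * qFin q (x * q) (n - k)) /
    (qFin q q k * qFin q q (n - k) * qFin q (b * c * d * x * q ^ (n + 1)) k)

/-- The closed form of the partial sums of the difference of two contiguous Jackson sums. -/
def jacksonCert (q b c d x : ℂ) (n k : ℕ) : ℂ :=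
  -(qFin q (b * c * d * x) (k + 1) * qFin q b (k + 1) * qFin q c (k + 1) * qFin q d (k + 1)) *
    (qPochInf q (c * d * x * q ^ (k + 2)) * qPochInf q (b * d * x * q ^ (k + 2)) *
      qPochInf q (b * c * x * q ^ (k + 2))) * (x * q) ^ (k + 1) *
    (1 - b * c * d * x * x * q ^ (k + 2)) *
    (qFin q (b * c * d * x * x * q ^ (n + 2)) k * qFin q (x * q * q) (n - 1 - k)) /
    (qFin q q k * qFin q q (n - 1 - k) * qFin q (b * c * d * x * q ^ (n + 1)) k * (1 - q ^ n))

/-- The factor relating two contiguous Jackson sums. -/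
def jacksonFactor (q b c d x : ℂ) (n : ℕ) : ℂ :=
  (1 - b * c * d * x) * (1 - b * x * q) * (1 - c * x * q) * (1 - d * x * q) / (1 - q ^ n)

/-- The telescoping step after division by the factor common to its four terms. Here `K = q^(k+1)`,
`S = q^(r+1)` and `K S = q^n` with `n = k + r + 2`; taking `K` and `S` as independent variables
leaves an identity of rational functions. -/
theorem jackson_step_rational (b c d x q K S : ℂ) (hK : 1 - K ≠ 0) (hS : 1 - S ≠ 0)
    (hKS : 1 - K * S ≠ 0) (ha : 1 - b * c * d * x * (K * S) * K ≠ 0) :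
    (1 - b * c * d * x * K ^ 2) * (1 - c * d * x * q * K) * (1 - b * d * x * q * K) *
        (1 - b * c * x * q * K) * (1 - b * c * d * x * x * q * (K * S)) * (1 - x * q) /
        ((1 - K) * (1 - S) * (1 - b * c * d * x * (K * S) * K)) -
      (1 - b * x * q) * (1 - c * x * q) * (1 - d * x * q) / (1 - K * S) *
        ((1 - b * c * d * x * q * K ^ 2) * (1 - b * c * d * x * K) * K *
          (1 - b * c * d * x * x * (K * S) * q * K) /
          ((1 - K) * (1 - b * c * d * x * (K * S) * K))) =
      -((1 - b * c * d * x * K) * (1 - b * K) * (1 - c * K) * (1 - d * K) * (x * q) *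
          (1 - b * c * d * x * x * q ^ 2 * K) * (1 - b * c * d * x * x * (K * S) * q * K) /
          ((1 - K) * (1 - b * c * d * x * (K * S) * K) * (1 - K * S))) -
      -((1 - c * d * x * q * K) * (1 - b * d * x * q * K) * (1 - b * c * x * q * K) *
          (1 - b * c * d * x * x * q * K) * (1 - x * q * S) / ((1 - S) * (1 - K * S))) := by
  generalize hA : 1 - b * c * d * x * (K * S) * K = A at *
  field_simp
  subst hA
  ring

/-- The base of the telescoping, treated apart because there is no certificate value before index
`0`. -/
theorem jacksonTerm_sub_zero {q : ℂ} (hq1 : ‖q‖ < 1) (b c d x : ℂ) (n : ℕ) :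
    jacksonTerm q b c d x (n + 1) 0 -
      jacksonFactor q b c d x (n + 1) * jacksonTerm q b c d (x * q) n 0 =
      jacksonCert q b c d x (n + 1) 0 := by
  have h1 := qPochInf_eq_one_sub_mul hq1 (c * d * x * q)
  have h2 := qPochInf_eq_one_sub_mul hq1 (b * d * x * q)
  have h3 := qPochInf_eq_one_sub_mul hq1 (b * c * x * q)
  have hn : (1 - q ^ (n + 1)) ≠ 0 := sub_ne_zero.2 (pow_succ_ne_one hq1 n).symm
  have e1 := qFin_succ q q n
  have e2 := qFin_succ_left q (x * q) n
  have hf := qFin_self_ne_zero hq1 n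
  rw [← pow_succ'] at e1
  simp only [jacksonTerm, jacksonCert, jacksonFactor, Nat.sub_zero, Nat.add_sub_cancel, e1, e2,
    qFin_zero, zero_add, pow_one, mul_zero, pow_zero, mul_one, one_mul, qFin_succ, h1, h2, h3]
  have g1 : c * d * (x * q) * q = c * d * x * q * q := by ring
  have g2 : b * d * (x * q) * q = b * d * x * q * q := by ring
  have g3 : b * c * (x * q) * q = b * c * x * q * q := by ring
  have g4 : c * d * x * q ^ 2 = c * d * x * q * q := by ring
  have g5 : b * d * x * q ^ 2 = b * d * x * q * q := by ring
  have g6 : b * c * x * q ^ 2 = b * c * x * q * q := by ring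
  rw [g1, g2, g3, g4, g5, g6]
  field_simp
  ring

/-- The upper index is written `k + r + 2`, so that `n - k` and its neighbours become `r` and `r +
1` and no truncated subtraction remains. The hypothesis keeps the denominators `(a q^(n+1))_j` away
from zero. -/
theorem jacksonTerm_sub_succ {q : ℂ} (hq1 : ‖q‖ < 1) (b c d x : ℂ) (k r : ℕ)
    (ha : ∀ i < k + r + 2, b * c * d * x * q ^ (k + r + 3 + i) ≠ 1) :
    jacksonTerm q b c d x (k + r + 2) (k + 1) -
      jacksonFactor q b c d x (k + r + 2) * jacksonTerm q b c d (x * q) (k + r + 1) (k + 1) =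
      jacksonCert q b c d x (k + r + 2) (k + 1) - jacksonCert q b c d x (k + r + 2) k := by
  have s1 : k + r + 2 - (k + 1) = r + 1 := by omega
  have s2 : k + r + 1 - (k + 1) = r := by omega
  have s3 : k + r + 2 - 1 - (k + 1) = r := by omega
  have s4 : k + r + 2 - 1 - k = r + 1 := by omega
  have hK : (1 - q ^ (k + 1)) ≠ 0 := sub_ne_zero.2 (pow_succ_ne_one hq1 k).symm
  have hS : (1 - q ^ (r + 1)) ≠ 0 := sub_ne_zero.2 (pow_succ_ne_one hq1 r).symm
  have hN : (1 - q ^ (k + 1) * q ^ (r + 1)) ≠ 0 := by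
    rw [← pow_add, ← add_assoc]
    exact sub_ne_zero.2 (pow_succ_ne_one hq1 _).symm
  have hA : 1 - b * c * d * x * (q ^ (k + 1) * q ^ (r + 1)) * q ^ (k + 1) ≠ 0 := by
    refine sub_ne_zero.2 fun h => ha k (by omega) ?_
    rw [h]; ring
  have hD : qFin q (b * c * d * x * q ^ (k + r + 3)) k ≠ 0 :=
    qFin_ne_zero fun j hj => by
      rw [mul_assoc, ← pow_add]
      exact ha j (by omega)
  have hfk := qFin_self_ne_zero hq1 k
  have hfr := qFin_self_ne_zero hq1 r
  have core := jackson_step_rational b c d x q (q ^ (k + 1)) (q ^ (r + 1)) hK hS hN hA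
  -- `C` collects the factors shared by both Jackson terms and both certificate values; what remains
  -- of each is rational in `q^(k+1)` and `q^(r+1)`.
  set C : ℂ := (qFin q (b * c * d * x) (k + 1) * qFin q b (k + 1) * qFin q c (k + 1) *
    qFin q d (k + 1)) * (qPochInf q (c * d * x * q ^ (k + 3)) *
      qPochInf q (b * d * x * q ^ (k + 3)) * qPochInf q (b * c * x * q ^ (k + 3))) *
      (x * q) ^ (k + 1) * (qFin q (b * c * d * x * x * q ^ (k + r + 4)) k *
      qFin q (x * q * q) r) / (qFin q q k * qFin q q r *
        qFin q (b * c * d * x * q ^ (k + r + 3)) k) with hC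
  have inf : ∀ y : ℂ, qPochInf q (y * q ^ (k + 2)) =
      (1 - y * q * q ^ (k + 1)) * qPochInf q (y * q ^ (k + 3)) := by
    intro y
    rw [qPochInf_eq_one_sub_mul hq1]
    congr 2 <;> ring
  have t1 : jacksonTerm q b c d x (k + r + 2) (k + 1) = C *
      ((1 - b * c * d * x * (q ^ (k + 1)) ^ 2) * (1 - c * d * x * q * q ^ (k + 1)) *
        (1 - b * d * x * q * q ^ (k + 1)) * (1 - b * c * x * q * q ^ (k + 1)) *
        (1 - b * c * d * x * x * q * (q ^ (k + 1) * q ^ (r + 1))) * (1 - x * q) /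
        ((1 - q ^ (k + 1)) * (1 - q ^ (r + 1)) *
          (1 - b * c * d * x * (q ^ (k + 1) * q ^ (r + 1)) * q ^ (k + 1)))) := by
    have f1 : qFin q (b * c * d * x * x * q ^ (k + r + 2 + 1)) (k + 1) =
        (1 - b * c * d * x * x * q * (q ^ (k + 1) * q ^ (r + 1))) *
          qFin q (b * c * d * x * x * q ^ (k + r + 4)) k := by
      rw [qFin_succ_left]
      congr 2 <;> ring
    have f2 : qFin q (b * c * d * x * q ^ (k + r + 2 + 1)) (k + 1) =
        qFin q (b * c * d * x * q ^ (k + r + 3)) k *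
          (1 - b * c * d * x * (q ^ (k + 1) * q ^ (r + 1)) * q ^ (k + 1)) := by
      rw [qFin_succ]
      congr 2; ring
    have f3 : ∀ j, qFin q q (j + 1) = qFin q q j * (1 - q ^ (j + 1)) := fun j => by
      rw [qFin_succ, ← pow_succ']
    rw [jacksonTerm, s1, f1, f2, f3, f3, qFin_succ_left q (x * q) r, show k + 1 + 1 = k + 2 from rfl,
      inf, inf, inf, hC, mul_comm 2 (k + 1), pow_mul]
    simp only [div_eq_mul_inv, mul_inv]
    ring
  have t2 : jacksonFactor q b c d x (k + r + 2) *
      jacksonTerm q b c d (x * q) (k + r + 1) (k + 1) = C *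
      ((1 - b * x * q) * (1 - c * x * q) * (1 - d * x * q) / (1 - q ^ (k + 1) * q ^ (r + 1)) *
        ((1 - b * c * d * x * q * (q ^ (k + 1)) ^ 2) * (1 - b * c * d * x * q ^ (k + 1)) *
          q ^ (k + 1) *
          (1 - b * c * d * x * x * (q ^ (k + 1) * q ^ (r + 1)) * q * q ^ (k + 1)) /
          ((1 - q ^ (k + 1)) *
            (1 - b * c * d * x * (q ^ (k + 1) * q ^ (r + 1)) * q ^ (k + 1))))) := by
    have f1 : qFin q (b * c * d * (x * q) * (x * q) * q ^ (k + r + 1 + 1)) (k + 1) =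
          qFin q (b * c * d * x * x * q ^ (k + r + 4)) k *
          (1 - b * c * d * x * x * (q ^ (k + 1) * q ^ (r + 1)) * q * q ^ (k + 1)) := by
      rw [qFin_succ]
      have : b * c * d * (x * q) * (x * q) * q ^ (k + r + 1 + 1) =
        b * c * d * x * x * q ^ (k + r + 4) := by ring
      rw [this]
      congr 2; ring
    have f2 : qFin q (b * c * d * (x * q) * q ^ (k + r + 1 + 1)) (k + 1) =
        qFin q (b * c * d * x * q ^ (k + r + 3)) k *
          (1 - b * c * d * x * (q ^ (k + 1) * q ^ (r + 1)) * q ^ (k + 1)) := by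
      have : b * c * d * (x * q) * q ^ (k + r + 1 + 1) =
        b * c * d * x * q ^ (k + r + 3) := by ring
      rw [qFin_succ, this]
      congr 2; ring
    have f3 : ∀ j, qFin q q (j + 1) = qFin q q j * (1 - q ^ (j + 1)) := fun j => by
      rw [qFin_succ, ← pow_succ']
    have f4 : (1 - b * c * d * x) * qFin q (b * c * d * (x * q)) (k + 1) =
        qFin q (b * c * d * x) (k + 1) * (1 - b * c * d * x * q ^ (k + 1)) := by
      rw [← qFin_succ q _ (k + 1), qFin_succ_left q (b * c * d * x) (k + 1),
        mul_assoc (b * c * d) x q]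
    have f5 : ∀ y : ℂ, y * (x * q) * q ^ (k + 1 + 1) = y * x * q ^ (k + 3) := fun y => by ring
    have f6 : 1 - q ^ (k + r + 2) = 1 - q ^ (k + 1) * q ^ (r + 1) := by ring
    have f7 : 1 - b * c * d * (x * q) * q ^ (2 * (k + 1)) =
      1 - b * c * d * x * q * (q ^ (k + 1)) ^ 2 := by ring
    have f8 : (x * q * q) ^ (k + 1) = (x * q) ^ (k + 1) * q ^ (k + 1) := by ring
    rw [jacksonFactor, jacksonTerm, s2, f1, f2, f3, f5, f5, f5, f6, f7, f8, hC]
    calc _ = (1 - b * x * q) * (1 - c * x * q) * (1 - d * x * q) /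
          (1 - q ^ (k + 1) * q ^ (r + 1)) * ((1 - b * c * d * x * q * (q ^ (k + 1)) ^ 2) *
          (((1 - b * c * d * x) * qFin q (b * c * d * (x * q)) (k + 1)) * qFin q b (k + 1) *
            qFin q c (k + 1) * qFin q d (k + 1)) * (qPochInf q (c * d * x * q ^ (k + 3)) *
          qPochInf q (b * d * x * q ^ (k + 3)) * qPochInf q (b * c * x * q ^ (k + 3))) *
          ((x * q) ^ (k + 1) * q ^ (k + 1)) *
          (qFin q (b * c * d * x * x * q ^ (k + r + 4)) k *
          (1 - b * c * d * x * x * (q ^ (k + 1) * q ^ (r + 1)) * q * q ^ (k + 1)) *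
          qFin q (x * q * q) r) / (qFin q q k * (1 - q ^ (k + 1)) * qFin q q r *
          (qFin q (b * c * d * x * q ^ (k + r + 3)) k *
          (1 - b * c * d * x * (q ^ (k + 1) * q ^ (r + 1)) * q ^ (k + 1))))) := by ring
      _ = _ := by
        rw [f4]
        simp only [div_eq_mul_inv, mul_inv]
        ring
  have t3 : jacksonCert q b c d x (k + r + 2) (k + 1) = C *
      -((1 - b * c * d * x * q ^ (k + 1)) * (1 - b * q ^ (k + 1)) * (1 - c * q ^ (k + 1)) *
          (1 - d * q ^ (k + 1)) * (x * q) *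
          (1 - b * c * d * x * x * q ^ 2 * q ^ (k + 1)) *
          (1 - b * c * d * x * x * (q ^ (k + 1) * q ^ (r + 1)) * q * q ^ (k + 1)) /
          ((1 - q ^ (k + 1)) * (1 - b * c * d * x * (q ^ (k + 1) * q ^ (r + 1)) * q ^ (k + 1)) *
            (1 - q ^ (k + 1) * q ^ (r + 1)))) := by
    have f1 : qFin q (b * c * d * x * x * q ^ (k + r + 2 + 2)) (k + 1) =
          qFin q (b * c * d * x * x * q ^ (k + r + 4)) k *
          (1 - b * c * d * x * x * (q ^ (k + 1) * q ^ (r + 1)) * q * q ^ (k + 1)) := by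
      rw [qFin_succ]
      congr 2; ring
    have f2 : qFin q (b * c * d * x * q ^ (k + r + 2 + 1)) (k + 1) =
        qFin q (b * c * d * x * q ^ (k + r + 3)) k *
          (1 - b * c * d * x * (q ^ (k + 1) * q ^ (r + 1)) * q ^ (k + 1)) := by
      rw [qFin_succ]
      congr 2; ring
    have f3 : ∀ j, qFin q q (j + 1) = qFin q q j * (1 - q ^ (j + 1)) := fun j => by
      rw [qFin_succ, ← pow_succ']
    have f5 : ∀ y : ℂ, y * q ^ (k + 1 + 2) = y * q ^ (k + 3) := fun y => by ring
    have f6 : 1 - q ^ (k + r + 2) = 1 - q ^ (k + 1) * q ^ (r + 1) := by ring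
    have f7 : 1 - b * c * d * x * x * q ^ (k + 3) =
      1 - b * c * d * x * x * q ^ 2 * q ^ (k + 1) := by ring
    rw [jacksonCert, s3, f1, f2, f3, f5, f5, f5, f5, f6, f7, hC, qFin_succ q _ (k + 1),
      qFin_succ q _ (k + 1), qFin_succ q _ (k + 1), qFin_succ q _ (k + 1), pow_succ (x * q) (k + 1)]
    simp only [div_eq_mul_inv, mul_inv]
    ring
  have t4 : jacksonCert q b c d x (k + r + 2) k = C *
      -((1 - c * d * x * q * q ^ (k + 1)) * (1 - b * d * x * q * q ^ (k + 1)) *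
          (1 - b * c * x * q * q ^ (k + 1)) *
          (1 - b * c * d * x * x * q * q ^ (k + 1)) * (1 - x * q * q ^ (r + 1)) /
          ((1 - q ^ (r + 1)) * (1 - q ^ (k + 1) * q ^ (r + 1)))) := by
    have f1 : qFin q (x * q * q) (r + 1) =
        qFin q (x * q * q) r * (1 - x * q * q ^ (r + 1)) := by
      rw [qFin_succ]
      congr 2; ring
    have f3 : ∀ j, qFin q q (j + 1) = qFin q q j * (1 - q ^ (j + 1)) := fun j => by
      rw [qFin_succ, ← pow_succ']
    have f6 : 1 - q ^ (k + r + 2) = 1 - q ^ (k + 1) * q ^ (r + 1) := by ring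
    have f7 : 1 - b * c * d * x * x * q ^ (k + 2) =
      1 - b * c * d * x * x * q * q ^ (k + 1) := by ring
    rw [jacksonCert, s4, f1, f3, f6, f7, inf, inf, inf, hC]
    simp only [div_eq_mul_inv, mul_inv]
    ring
  rw [t1, t2, t3, t4, ← mul_sub, core, ← mul_sub]

theorem sum_jacksonTerm_sub {q : ℂ} (hq1 : ‖q‖ < 1) (b c d x : ℂ) (n : ℕ)
    (ha : ∀ i < n + 1, b * c * d * x * q ^ (n + 2 + i) ≠ 1) (k : ℕ) (hk : k ≤ n) :
    ∑ j ∈ Finset.range (k + 1), (jacksonTerm q b c d x (n + 1) j -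
      jacksonFactor q b c d x (n + 1) * jacksonTerm q b c d (x * q) n j) =
      jacksonCert q b c d x (n + 1) k := by
  induction k with
  | zero => simpa using jacksonTerm_sub_zero hq1 b c d x n
  | succ k ih =>
    rw [Finset.sum_range_succ, ih (by omega)]
    obtain ⟨r, rfl⟩ := Nat.exists_eq_add_of_le hk
    have := jacksonTerm_sub_succ hq1 b c d x k r (by
      intro i hi
      have := ha i (by omega)
      rwa [show k + 1 + r + 2 + i = k + r + 3 + i by omega] at this)
    rw [show k + 1 + r + 1 = k + r + 2 by omega, show k + 1 + r = k + r + 1 by omega, this]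
    ring

/-- The longer sum has one term more than the shorter one; that term cancels the telescoped
remainder, so the two sides of the contiguous relation agree exactly. -/
theorem jacksonTerm_last {q : ℂ} (hq1 : ‖q‖ < 1) (b c d x : ℂ) (n : ℕ)
    (ha : ∀ i < n + 1, b * c * d * x * q ^ (n + 2 + i) ≠ 1) :
    jacksonTerm q b c d x (n + 1) (n + 1) = -jacksonCert q b c d x (n + 1) n := by
  have hn : (1 - q ^ (n + 1)) ≠ 0 := sub_ne_zero.2 (pow_succ_ne_one hq1 n).symm
  have hA : 1 - b * c * d * x * q ^ (2 * (n + 1)) ≠ 0 :=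
    sub_ne_zero.2 fun h => ha n (by omega) (by rw [h]; ring)
  have hD : qFin q (b * c * d * x * q ^ (n + 2)) n ≠ 0 :=
    qFin_ne_zero fun j hj => by
      rw [mul_assoc, ← pow_add]
      exact ha j (by omega)
  have hf := qFin_self_ne_zero hq1 n
  have f1 : qFin q (b * c * d * x * x * q ^ (n + 1 + 1)) (n + 1) =
      (1 - b * c * d * x * x * q ^ (n + 2)) * qFin q (b * c * d * x * x * q ^ (n + 3)) n := by
    rw [qFin_succ_left]
    congr 2; ring
  have f2 : qFin q (b * c * d * x * q ^ (n + 1 + 1)) (n + 1) =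
      qFin q (b * c * d * x * q ^ (n + 2)) n * (1 - b * c * d * x * q ^ (2 * (n + 1))) := by
    rw [qFin_succ]
    congr 2; ring
  have f3 : qFin q q (n + 1) = qFin q q n * (1 - q ^ (n + 1)) := by
    rw [qFin_succ, ← pow_succ']
  rw [jacksonTerm, jacksonCert, Nat.sub_self, Nat.add_sub_cancel, Nat.sub_self, f1, f2, f3]
  simp only [qFin_zero, show n + 1 + 1 = n + 2 from rfl, show n + 1 + 2 = n + 3 from rfl]
  field_simp

/-- Jackson's sum of a terminating very-well-poised balanced `₈φ₇`. -/
theorem sum_jacksonTerm {q : ℂ} (hq1 : ‖q‖ < 1) (b c d : ℂ) (n : ℕ) : ∀ x : ℂ,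
    (∀ i < n, b * c * d * x * q ^ (n + 1 + i) ≠ 1) →
    ∑ k ∈ Finset.range (n + 1), jacksonTerm q b c d x n k =
      qFin q (b * c * d * x) (n + 1) *
        (qFin q (d * x * q) n * qFin q (c * x * q) n * qFin q (b * x * q) n) *
        (qPochInf q (c * d * x * q ^ (n + 1)) * qPochInf q (b * d * x * q ^ (n + 1)) *
          qPochInf q (b * c * x * q ^ (n + 1))) / qFin q q n := by
  induction n with
  | zero =>
    intro x _
    simp [jacksonTerm, qFin_succ]
  | succ n ih =>
    intro x ha
    have hsum := sum_jacksonTerm_sub hq1 b c d x n ha n le_rfl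
    have hlast := jacksonTerm_last hq1 b c d x n ha
    -- Replacing `x` by `x q` with `b`, `c`, `d` fixed moves the base from `a` to `a q`, so the
    -- nonvanishing condition for `n` follows from the one for `n + 1`.
    have hrec := ih (x * q) (fun i hi h => ha i (by omega) (by rw [← h]; ring))
    rw [Finset.sum_sub_distrib, ← Finset.mul_sum, hrec] at hsum
    have hn : (1 - q ^ (n + 1)) ≠ 0 := sub_ne_zero.2 (pow_succ_ne_one hq1 n).symm
    have hf := qFin_self_ne_zero hq1 n
    have f1 : ∀ y : ℂ, qFin q (y * x * q) (n + 1) = (1 - y * x * q) * qFin q (y * (x * q) * q) n :=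
      fun y => by rw [qFin_succ_left, mul_assoc y x q]
    have f2 : ∀ y : ℂ, y * (x * q) * q ^ (n + 1) = y * x * q ^ (n + 1 + 1) := fun y => by ring
    have f3 : qFin q q (n + 1) = qFin q q n * (1 - q ^ (n + 1)) := by
      rw [qFin_succ, ← pow_succ']
    rw [Finset.sum_range_succ, hlast, ← hsum, neg_sub, add_sub_cancel, jacksonFactor, f1, f1, f1,
      f3, f2, f2, f2, qFin_succ_left q (b * c * d * x) (n + 1), mul_assoc (b * c * d) x q]
    generalize 1 - b * c * d * x = u, 1 - b * x * q = u₁, 1 - c * x * q = u₂,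
      1 - d * x * q = u₃, 1 - q ^ (n + 1) = u₄
    ring

/-! ### Bounds and limits of `q`-shifted factorials -/

theorem sum_norm_mul_pow_le {q : ℂ} (hq1 : ‖q‖ < 1) (a : ℂ) (n : ℕ) :
    ∑ j ∈ Finset.range n, ‖-(a * q ^ j)‖ ≤ ‖a‖ / (1 - ‖q‖) := by
  simp only [norm_neg, norm_mul, norm_pow, ← Finset.mul_sum]
  rw [div_eq_mul_inv, ← tsum_geometric_of_lt_one (norm_nonneg q) hq1]
  gcongr
  exact (summable_geometric_of_lt_one (norm_nonneg q) hq1).sum_le_tsum _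
    fun i _ => pow_nonneg (norm_nonneg q) i

/-- From `|∏ (1 + x_j) - 1| ≤ exp (∑ |x_j|) - 1` and a geometric series. The bound is uniform in `n`
and tends to `0` with `a`; the boundedness of the factorials and the limits as `a q^n → 0` both rest
on it. -/
theorem norm_qFin_sub_one_le {q : ℂ} (hq1 : ‖q‖ < 1) (a : ℂ) (n : ℕ) :
    ‖qFin q a n - 1‖ ≤ Real.exp (‖a‖ / (1 - ‖q‖)) - 1 := by
  have h := Finset.norm_prod_one_add_sub_one_le (Finset.range n) (fun j => -(a * q ^ j))
  simp only [← sub_eq_add_neg] at h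
  exact h.trans (sub_le_sub_right (Real.exp_le_exp.2 (sum_norm_mul_pow_le hq1 a n)) 1)

theorem norm_qFin_le {q : ℂ} (hq1 : ‖q‖ < 1) (a : ℂ) (n : ℕ) :
    ‖qFin q a n‖ ≤ Real.exp (‖a‖ / (1 - ‖q‖)) := by
  have h := norm_sub_norm_le (qFin q a n) 1
  have := norm_qFin_sub_one_le hq1 a n
  rw [norm_one] at h
  linarith

theorem summable_norm_mul_pow {q : ℂ} (hq1 : ‖q‖ < 1) (a : ℂ) :
    Summable fun j : ℕ => ‖-(a * q ^ j)‖ := by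
  simp only [norm_neg, norm_mul, norm_pow]
  exact (summable_geometric_of_lt_one (norm_nonneg q) hq1).mul_left _

theorem tendsto_qFin {q : ℂ} (hq1 : ‖q‖ < 1) (a : ℂ) :
    Tendsto (qFin q a) atTop (𝓝 (qPochInf q a)) := by
  have h := multipliable_one_add_of_summable (summable_norm_mul_pow hq1 a)
  simp only [← sub_eq_add_neg] at h
  exact h.hasProd.tendsto_prod_nat

theorem norm_qPochInf_sub_one_le {q : ℂ} (hq1 : ‖q‖ < 1) (a : ℂ) :
    ‖qPochInf q a - 1‖ ≤ Real.exp (‖a‖ / (1 - ‖q‖)) - 1 :=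
  le_of_tendsto ((tendsto_qFin hq1 a).sub_const 1).norm
    (Eventually.of_forall (norm_qFin_sub_one_le hq1 a))

theorem qPochInf_ne_zero {q a : ℂ} (hq1 : ‖q‖ < 1) (h : ∀ j : ℕ, a * q ^ j ≠ 1) :
    qPochInf q a ≠ 0 := by
  have := tprod_one_add_ne_zero_of_summable (f := fun j : ℕ => -(a * q ^ j))
    (fun j => by
      rw [← sub_eq_add_neg]
      exact sub_ne_zero.2 (h j).symm) (summable_norm_mul_pow hq1 a)
  simp only [← sub_eq_add_neg] at this
  exact this

theorem qPochInf_ne_zero_of_norm_lt_one {q a : ℂ} (hq1 : ‖q‖ < 1) (ha : ‖a‖ < 1) :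
    qPochInf q a ≠ 0 :=
  qPochInf_ne_zero hq1 fun j h => by
    have h1 : ‖a‖ * ‖q‖ ^ j = 1 := by rw [← norm_pow, ← norm_mul, h, norm_one]
    have h2 : ‖a‖ * ‖q‖ ^ j ≤ ‖a‖ :=
      mul_le_of_le_one_right (norm_nonneg a) (pow_le_one₀ (norm_nonneg q) hq1.le)
    linarith

theorem norm_mul_pow_le {q : ℂ} (hq1 : ‖q‖ < 1) (a : ℂ) (n : ℕ) : ‖a * q ^ n‖ ≤ ‖a‖ := by
  rw [norm_mul, norm_pow]
  exact mul_le_of_le_one_right (norm_nonneg a) (pow_le_one₀ (norm_nonneg q) hq1.le)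

theorem tendsto_mul_pow {q : ℂ} (hq1 : ‖q‖ < 1) (a : ℂ) :
    Tendsto (fun n : ℕ => a * q ^ n) atTop (𝓝 0) := by
  simpa using (tendsto_pow_atTop_nhds_zero_of_norm_lt_one hq1).const_mul a

theorem tendsto_exp_norm_mul_pow {q : ℂ} (hq1 : ‖q‖ < 1) (a : ℂ) :
    Tendsto (fun n : ℕ => Real.exp (‖a * q ^ n‖ / (1 - ‖q‖)) - 1) atTop (𝓝 0) := by
  have h := ((tendsto_mul_pow hq1 a).norm.div_const (1 - ‖q‖)).rexp.sub_const 1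
  simpa using h

theorem tendsto_qPochInf_mul_pow {q : ℂ} (hq1 : ‖q‖ < 1) (a : ℂ) :
    Tendsto (fun n : ℕ => qPochInf q (a * q ^ n)) atTop (𝓝 1) := by
  rw [tendsto_iff_norm_sub_tendsto_zero]
  exact squeeze_zero (fun _ => norm_nonneg _) (fun n => norm_qPochInf_sub_one_le hq1 _)
    (tendsto_exp_norm_mul_pow hq1 a)

theorem tendsto_qFin_mul_pow {q : ℂ} (hq1 : ‖q‖ < 1) (a : ℂ) (k : ℕ) :
    Tendsto (fun n : ℕ => qFin q (a * q ^ n) k) atTop (𝓝 1) := by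
  rw [tendsto_iff_norm_sub_tendsto_zero]
  exact squeeze_zero (fun _ => norm_nonneg _) (fun n => norm_qFin_sub_one_le hq1 _ k)
    (tendsto_exp_norm_mul_pow hq1 a)

/-- A family of complex numbers is bounded. -/
def BddFamily {ι : Type*} (f : ι → ℂ) : Prop := ∃ C : ℝ, ∀ i, ‖f i‖ ≤ C

namespace BddFamily

variable {ι κ : Type*} {f g : ι → ℂ}

theorem mul (hf : BddFamily f) (hg : BddFamily g) : BddFamily fun i => f i * g i := by
  obtain ⟨C, hC⟩ := hf
  obtain ⟨D, hD⟩ := hg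
  refine ⟨C * D, fun i => ?_⟩
  rw [norm_mul]
  exact mul_le_mul (hC i) (hD i) (norm_nonneg _) ((norm_nonneg _).trans (hC i))

theorem comp {f : κ → ℂ} (hf : BddFamily f) (s : ι → κ) : BddFamily fun i => f (s i) :=
  hf.imp fun _ h i => h (s i)

theorem of_tendsto {f : ℕ → ℂ} {l : ℂ} (h : Tendsto f atTop (𝓝 l)) : BddFamily f := by
  obtain ⟨C, hC⟩ := h.norm.bddAbove_range
  exact ⟨C, fun i => hC ⟨i, rfl⟩⟩

end BddFamily

theorem bddFamily_qFin {q : ℂ} (hq1 : ‖q‖ < 1) (a : ℂ) : BddFamily (qFin q a) :=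
  ⟨_, norm_qFin_le hq1 a⟩

theorem bddFamily_qFin_mul_pow {q : ℂ} (hq1 : ‖q‖ < 1) (a : ℂ) :
    BddFamily fun p : ℕ × ℕ => qFin q (a * q ^ p.1) p.2 :=
  ⟨Real.exp (‖a‖ / (1 - ‖q‖)), fun p => (norm_qFin_le hq1 _ _).trans <| by
    have := norm_mul_pow_le hq1 a p.1
    have h1 : 0 < 1 - ‖q‖ := by linarith
    gcongr⟩

/-- The factorials converge to a nonzero limit, so their reciprocals converge as well. -/
theorem bddFamily_qFin_inv {q a : ℂ} (hq1 : ‖q‖ < 1) (h : ∀ j : ℕ, a * q ^ j ≠ 1) :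
    BddFamily fun n => (qFin q a n)⁻¹ :=
  .of_tendsto ((tendsto_qFin hq1 a).inv₀ (qPochInf_ne_zero hq1 h))

theorem self_mul_pow_ne_one {q : ℂ} (hq1 : ‖q‖ < 1) (j : ℕ) : q * q ^ j ≠ 1 := by
  rw [← pow_succ']
  exact pow_succ_ne_one hq1 j

theorem bddFamily_qFin_self_inv {q : ℂ} (hq1 : ‖q‖ < 1) :
    BddFamily fun n => (qFin q q n)⁻¹ :=
  bddFamily_qFin_inv hq1 (self_mul_pow_ne_one hq1)

theorem bddFamily_qPochInf_mul_pow {q : ℂ} (hq1 : ‖q‖ < 1) (a : ℂ) :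
    BddFamily fun n : ℕ => qPochInf q (a * q ^ n) :=
  .of_tendsto (tendsto_qPochInf_mul_pow hq1 a)

theorem BddFamily.summable_mul_pow {f : ℕ → ℂ} (hf : BddFamily f) {z : ℂ} (hz : ‖z‖ < 1) :
    Summable fun n => f n * z ^ n := by
  obtain ⟨C, hC⟩ := hf
  refine Summable.of_norm_bounded
    ((summable_geometric_of_lt_one (norm_nonneg z) hz).mul_left C) fun n => ?_
  rw [norm_mul, norm_pow]
  exact mul_le_mul_of_nonneg_right (hC n) (by positivity)

/-! ### The nonterminating very-well-poised `₆φ₅` sum -/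

/-- The coefficient of `(x q)^k` in the very-well-poised `₆φ₅` series with base `a = b c d x`,
cleared of the lower parameters `a q / b`, `a q / c`, `a q / d`. -/
def sixCoeff (q b c d x : ℂ) (k : ℕ) : ℂ :=
  (1 - b * c * d * x * q ^ (2 * k)) *
    (qFin q (b * c * d * x) k * qFin q b k * qFin q c k * qFin q d k) *
    (qPochInf q (c * d * x * q ^ (k + 1)) * qPochInf q (b * d * x * q ^ (k + 1)) *
      qPochInf q (b * c * x * q ^ (k + 1))) * (qFin q q k)⁻¹

theorem bddFamily_one_sub_mul_pow {q : ℂ} (hq1 : ‖q‖ < 1) (a : ℂ) :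
    BddFamily fun k : ℕ => 1 - a * q ^ (2 * k) :=
  BddFamily.comp (f := fun k : ℕ => 1 - a * q ^ k)
    (.of_tendsto (tendsto_const_nhds.sub (tendsto_mul_pow hq1 a))) (fun k => 2 * k)

theorem bddFamily_sixCoeff {q : ℂ} (hq1 : ‖q‖ < 1) (b c d x : ℂ) :
    BddFamily (sixCoeff q b c d x) :=
  ((bddFamily_one_sub_mul_pow hq1 _).mul
    ((((bddFamily_qFin hq1 _).mul (bddFamily_qFin hq1 _)).mul (bddFamily_qFin hq1 _)).mul
      (bddFamily_qFin hq1 _))).mul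
    ((((bddFamily_qPochInf_mul_pow hq1 _).comp (fun k => k + 1)).mul
      ((bddFamily_qPochInf_mul_pow hq1 _).comp (fun k => k + 1))).mul
      ((bddFamily_qPochInf_mul_pow hq1 _).comp (fun k => k + 1))) |>.mul
    (bddFamily_qFin_self_inv hq1)

/-- Separates what is independent of `n` from a last factor that is bounded, uniformly in `k ≤ n`
for large `n`, and tends to `(x q)_∞ / (q)_∞`. -/
theorem jacksonTerm_eq_sixCoeff_mul (q b c d x : ℂ) (n k : ℕ) :
    jacksonTerm q b c d x n k = sixCoeff q b c d x k * (x * q) ^ k *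
      (qFin q (b * c * d * x * x * q * q ^ n) k * qFin q (x * q) (n - k) *
        (qFin q q (n - k))⁻¹ * (qFin q (b * c * d * x * q * q ^ n) k)⁻¹) := by
  have e1 : ∀ y : ℂ, y * q ^ (n + 1) = y * q * q ^ n := fun y => by ring
  rw [jacksonTerm, sixCoeff, e1, e1]
  simp only [div_eq_mul_inv, mul_inv]
  ring

/-- Once `(a q^n)_k` is within `1/2` of `1`, uniformly in `k`, its reciprocal has norm at most `2`.
This gives the domination without any condition on the base. -/
theorem eventually_norm_qFin_inv_le {q : ℂ} (hq1 : ‖q‖ < 1) (a : ℂ) :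
    ∀ᶠ n : ℕ in atTop, ∀ k, ‖(qFin q (a * q ^ n) k)⁻¹‖ ≤ 2 := by
  filter_upwards [(tendsto_exp_norm_mul_pow hq1 a).eventually_lt_const one_half_pos] with n hn k
  have h1 := norm_qFin_sub_one_le hq1 (a * q ^ n) k
  have h2 := norm_sub_norm_le 1 (1 - qFin q (a * q ^ n) k)
  rw [norm_one, sub_sub_cancel, norm_sub_rev] at h2
  rw [norm_inv]
  exact inv_le_of_inv_le₀ two_pos (by rw [← one_div]; linarith)

/-- The nonterminating very-well-poised `₆φ₅` sum. -/
theorem tsum_sixCoeff {q : ℂ} (hq1 : ‖q‖ < 1) (b c d x : ℂ) (hx : ‖x * q‖ < 1) :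
    ∑' k, sixCoeff q b c d x k * (x * q) ^ k =
      qPochInf q (b * c * d * x) *
        (qPochInf q (d * x * q) * qPochInf q (c * x * q) * qPochInf q (b * x * q)) /
        qPochInf q (x * q) := by
  have hq0 : qPochInf q q ≠ 0 := qPochInf_ne_zero_of_norm_lt_one hq1 hq1
  have hxq : qPochInf q (x * q) ≠ 0 := qPochInf_ne_zero_of_norm_lt_one hq1 hx
  -- The cutoff is needed because for `k > n` the truncated `n - k` is `0` and the formula for the
  -- term need not vanish.
  set f : ℕ → ℕ → ℂ := fun n k => if k < n + 1 then jacksonTerm q b c d x n k else 0 with hf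
  have hsum : ∀ n, ∑' k, f n k = ∑ k ∈ Finset.range (n + 1), jacksonTerm q b c d x n k := by
    intro n
    rw [tsum_eq_sum (s := Finset.range (n + 1)) fun k hk => by
      simp only [hf, if_neg (fun h => hk (Finset.mem_range.2 h))]]
    exact Finset.sum_congr rfl fun k hk => if_pos (Finset.mem_range.1 hk)
  have hlim : Tendsto (fun n => ∑' k, f n k) atTop
      (𝓝 (∑' k, sixCoeff q b c d x k * (x * q) ^ k * (qPochInf q (x * q) * (qPochInf q q)⁻¹))) := by
    obtain ⟨C, hC⟩ := bddFamily_sixCoeff hq1 b c d x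
    obtain ⟨D, hD⟩ := bddFamily_qFin_mul_pow hq1 (b * c * d * x * x * q)
    obtain ⟨E, hE⟩ := bddFamily_qFin hq1 (x * q)
    obtain ⟨F, hF⟩ := bddFamily_qFin_self_inv hq1
    have hC0 : 0 ≤ C := (norm_nonneg _).trans (hC 0)
    have hD0 : 0 ≤ D := (norm_nonneg _).trans (hD (0, 0))
    have hE0 : 0 ≤ E := (norm_nonneg _).trans (hE 0)
    have hF0 : 0 ≤ F := (norm_nonneg _).trans (hF 0)
    refine tendsto_tsum_of_dominated_convergence
      (bound := fun k => C * ‖x * q‖ ^ k * (D * E * F * 2)) ?_ ?_ ?_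
    · exact ((summable_geometric_of_lt_one (norm_nonneg _) hx).mul_left C).mul_right _
    · intro k
      have h1 : Tendsto (fun n => qFin q (b * c * d * x * x * q * q ^ n) k *
          qFin q (x * q) (n - k) * (qFin q q (n - k))⁻¹ *
          (qFin q (b * c * d * x * q * q ^ n) k)⁻¹) atTop
          (𝓝 (1 * qPochInf q (x * q) * (qPochInf q q)⁻¹ * 1⁻¹)) :=
        (((tendsto_qFin_mul_pow hq1 _ k).mul ((tendsto_qFin hq1 _).comp
          (tendsto_sub_atTop_nat k))).mul (((tendsto_qFin hq1 _).comp
          (tendsto_sub_atTop_nat k)).inv₀ hq0)).mul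
          ((tendsto_qFin_mul_pow hq1 _ k).inv₀ one_ne_zero)
      rw [one_mul, inv_one, mul_one] at h1
      refine (h1.const_mul _).congr' ?_
      filter_upwards [eventually_ge_atTop k] with n hn
      rw [hf]
      simp only [if_pos (Nat.lt_succ_of_le hn)]
      rw [jacksonTerm_eq_sixCoeff_mul]
    · filter_upwards [eventually_norm_qFin_inv_le hq1 (b * c * d * x * q)] with n hn k
      simp only [hf]
      split_ifs with h
      · rw [jacksonTerm_eq_sixCoeff_mul]
        simp only [norm_mul, norm_pow]
        have g1 := hC k
        have g2 := hD (n, k)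
        have g3 := hE (n - k)
        have g4 := hF (n - k)
        have g5 := hn k
        simp only at g2
        gcongr
      · rw [norm_zero]
        positivity
  have hrhs : Tendsto (fun n => ∑' k, f n k) atTop
      (𝓝 (qPochInf q (b * c * d * x) *
        (qPochInf q (d * x * q) * qPochInf q (c * x * q) * qPochInf q (b * x * q)) *
        (1 * 1 * 1) / qPochInf q q)) := by
    have sh : Tendsto (fun n : ℕ => n + 1) atTop atTop := tendsto_add_atTop_nat 1
    refine Tendsto.congr' ?_ ((((tendsto_qFin hq1 _).comp sh).mul
      (((tendsto_qFin hq1 (d * x * q)).mul (tendsto_qFin hq1 (c * x * q))).mul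
        (tendsto_qFin hq1 (b * x * q)))).mul
      ((((tendsto_qPochInf_mul_pow hq1 (c * d * x)).comp sh).mul
        ((tendsto_qPochInf_mul_pow hq1 (b * d * x)).comp sh)).mul
        ((tendsto_qPochInf_mul_pow hq1 (b * c * x)).comp sh)) |>.div (tendsto_qFin hq1 q) hq0)
    -- Jackson's sum needs `a q^(n+1+i) ≠ 1`, which is automatic for large `n`; this suffices for
    -- the limit.
    have hlt : ∀ᶠ n : ℕ in atTop, ‖b * c * d * x * q ^ n‖ < 1 := by
      have := (tendsto_mul_pow hq1 (b * c * d * x)).norm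
      rw [norm_zero] at this
      exact this.eventually_lt_const one_pos
    filter_upwards [hlt] with n hn
    rw [hsum, sum_jacksonTerm hq1 b c d n x]
    · rfl
    · intro i _ h
      have h1 := norm_mul_pow_le hq1 (b * c * d * x * q ^ n) (1 + i)
      rw [mul_assoc, ← pow_add, ← add_assoc, h, norm_one] at h1
      exact absurd hn (not_lt.2 h1)
  have := tendsto_nhds_unique hlim hrhs
  rw [tsum_mul_right] at this
  rw [← mul_assoc, ← div_eq_mul_inv, mul_one, mul_one, mul_one] at this
  rw [eq_div_iff hxq]
  exact (div_left_inj' hq0).1 this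

/-! ### The nonterminating very-well-poised `₈φ₇` transformation -/

/-- The coefficients of the very-well-poised `₈φ₇` series with base `a`, cleared of the lower
parameters `a q / b`, …, `a q / f`. -/
def eightCoeff (q a b c d e f : ℂ) (n : ℕ) : ℂ :=
  (1 - a * q ^ (2 * n)) *
    (qFin q a n * qFin q b n * qFin q c n * qFin q d n * qFin q e n * qFin q f n) *
    (qPochInf q (a / b * q ^ (n + 1)) * qPochInf q (a / c * q ^ (n + 1)) *
      qPochInf q (a / d * q ^ (n + 1)) * qPochInf q (a / e * q ^ (n + 1)) *
      qPochInf q (a / f * q ^ (n + 1))) * (qFin q q n)⁻¹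

theorem bddFamily_eightCoeff {q : ℂ} (hq1 : ‖q‖ < 1) (a b c d e f : ℂ) :
    BddFamily (eightCoeff q a b c d e f) := by
  have hF := bddFamily_qFin hq1
  have hI : ∀ y : ℂ, BddFamily fun k : ℕ => qPochInf q (y * q ^ (k + 1)) := fun y =>
    (bddFamily_qPochInf_mul_pow hq1 y).comp (fun k => k + 1)
  exact (((bddFamily_one_sub_mul_pow hq1 a).mul
    ((((((hF a).mul (hF b)).mul (hF c)).mul (hF d)).mul (hF e)).mul (hF f))).mul
    (((((hI (a / b)).mul (hI (a / c))).mul (hI (a / d))).mul (hI (a / e))).mul (hI (a / f)))).mul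
    (bddFamily_qFin_self_inv hq1)

/-- The expansion of a quotient of `q`-shifted factorials given by Jackson's sum. -/
theorem bailey_expansion {q a lam b c d : ℂ} (hq0 : q ≠ 0) (hq1 : ‖q‖ < 1) (ha : a ≠ 0)
    (hb : b ≠ 0) (hc : c ≠ 0) (hd : d ≠ 0) (hlam0 : lam ≠ 0)
    (hbal : lam * (b * c * d) = q * a ^ 2) (hlam : ∀ j : ℕ, lam * q ^ j ≠ 1) (n : ℕ) :
    qFin q a n * qFin q b n * qFin q c n * qFin q d n *
      (qPochInf q (a / b * q ^ (n + 1)) * qPochInf q (a / c * q ^ (n + 1)) *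
        qPochInf q (a / d * q ^ (n + 1))) * (qFin q q n)⁻¹ =
    ∑ k ∈ Finset.range (n + 1),
      sixCoeff q (lam * b / a) (lam * c / a) (lam * d / a) (a / (lam * q)) k * (a / lam) ^ k *
        (qFin q a (k + (n - k) + k) * qFin q (a / lam) (n - k) * (qFin q q (n - k))⁻¹ *
          (qFin q lam (k + (n - k) + k + 1))⁻¹) := by
  -- Jackson's sum is used with upper parameters `λb/a`, `λc/a`, `λd/a` and `x = a/(λq)`. The
  -- balance condition makes its base equal to `λ` and turns its lower-parameter products into those
  -- of `a/b`, `a/c`, `a/d`.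
  have p1 : lam * b / a * (lam * c / a) * (lam * d / a) * (a / (lam * q)) = lam := by
    field_simp
    linear_combination hbal
  have p2 : lam * c / a * (lam * d / a) * (a / (lam * q)) = a / b := by
    field_simp
    linear_combination hbal
  have p3 : lam * b / a * (lam * d / a) * (a / (lam * q)) = a / c := by
    field_simp
    linear_combination hbal
  have p4 : lam * b / a * (lam * c / a) * (a / (lam * q)) = a / d := by
    field_simp
    linear_combination hbal
  have p5 : a / (lam * q) * q = a / lam := by field_simp
  have p6 : ∀ y : ℂ, lam * y / a * (a / (lam * q)) * q = y := fun y => by field_simp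
  have p7 : lam * (a / (lam * q)) * q = a := by field_simp
  have hJ := sum_jacksonTerm hq1 (lam * b / a) (lam * c / a) (lam * d / a) n (a / (lam * q))
    (fun i _ => by rw [p1]; exact hlam _)
  simp only [jacksonTerm_eq_sixCoeff_mul] at hJ
  rw [p1, p2, p3, p4, p5, p6, p6, p6, p7] at hJ
  have hl : ∀ j, qFin q lam j ≠ 0 := fun j => qFin_ne_zero fun i _ => hlam i
  have hq := qFin_self_ne_zero hq1 n
  have hJ' : qFin q b n * qFin q c n * qFin q d n *
      (qPochInf q (a / b * q ^ (n + 1)) * qPochInf q (a / c * q ^ (n + 1)) *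
        qPochInf q (a / d * q ^ (n + 1))) * (qFin q q n)⁻¹ = (qFin q lam (n + 1))⁻¹ *
      ∑ k ∈ Finset.range (n + 1),
        sixCoeff q (lam * b / a) (lam * c / a) (lam * d / a) (a / (lam * q)) k * (a / lam) ^ k *
        (qFin q (a * q ^ n) k * qFin q (a / lam) (n - k) * (qFin q q (n - k))⁻¹ *
          (qFin q (lam * q * q ^ n) k)⁻¹) := by
    rw [hJ]
    have := hl (n + 1)
    field_simp
  calc _ = qFin q a n * (qFin q b n * qFin q c n * qFin q d n *
      (qPochInf q (a / b * q ^ (n + 1)) * qPochInf q (a / c * q ^ (n + 1)) *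
        qPochInf q (a / d * q ^ (n + 1))) * (qFin q q n)⁻¹) := by ring
    _ = _ := by
      rw [hJ', Finset.mul_sum, Finset.mul_sum]
      refine Finset.sum_congr rfl fun k hk => ?_
      have hk' : k + (n - k) = n := Nat.add_sub_cancel' (Nat.lt_succ_iff.1 (Finset.mem_range.1 hk))
      rw [hk', qFin_add q a n k, show n + k + 1 = n + 1 + k by omega, qFin_add q lam (n + 1) k,
        mul_inv, pow_succ' q n, ← mul_assoc lam q]
      ring

/-- The double series from which both sides of the `₈φ₇` transformation arise. -/
def baileyDouble (q a lam b c d e f : ℂ) (p : ℕ × ℕ) : ℂ :=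
  (1 - a * q ^ (2 * (p.1 + p.2))) * (qFin q e (p.1 + p.2) * qFin q f (p.1 + p.2)) *
    (qPochInf q (a / e * q ^ (p.1 + p.2 + 1)) * qPochInf q (a / f * q ^ (p.1 + p.2 + 1))) *
    (lam * q / (e * f)) ^ (p.1 + p.2) *
    (sixCoeff q (lam * b / a) (lam * c / a) (lam * d / a) (a / (lam * q)) p.1 * (a / lam) ^ p.1 *
      (qFin q a (p.1 + p.2 + p.1) * qFin q (a / lam) p.2 * (qFin q q p.2)⁻¹ *
        (qFin q lam (p.1 + p.2 + p.1 + 1))⁻¹))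

/-- Apart from bounded factors, the entry at `(k, r)` is `(a/λ)^k (λq/(ef))^(k+r) = (aq/(ef))^k
(λq/(ef))^r`, a product of two geometric series. -/
theorem summable_baileyDouble {q a lam b c d e f : ℂ} (hq1 : ‖q‖ < 1) (hlam0 : lam ≠ 0)
    (hlam : ∀ j : ℕ, lam * q ^ j ≠ 1)
    (hz : ‖lam * q / (e * f)‖ < 1) (hz' : ‖a * q / (e * f)‖ < 1) :
    Summable (baileyDouble q a lam b c d e f) := by
  have hF := bddFamily_qFin hq1
  have hI : ∀ y : ℂ, BddFamily fun k : ℕ => qPochInf q (y * q ^ (k + 1)) := fun y =>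
    (bddFamily_qPochInf_mul_pow hq1 y).comp (fun k => k + 1)
  set s : ℕ × ℕ → ℕ := fun p => p.1 + p.2
  have hB : BddFamily fun p : ℕ × ℕ => (1 - a * q ^ (2 * s p)) * (qFin q e (s p) * qFin q f (s p)) *
      (qPochInf q (a / e * q ^ (s p + 1)) * qPochInf q (a / f * q ^ (s p + 1))) *
      (sixCoeff q (lam * b / a) (lam * c / a) (lam * d / a) (a / (lam * q)) p.1 *
      (qFin q a (s p + p.1) * qFin q (a / lam) p.2 * (qFin q q p.2)⁻¹ *
        (qFin q lam (s p + p.1 + 1))⁻¹)) :=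
    ((((bddFamily_one_sub_mul_pow hq1 a).comp s).mul (((hF e).comp s).mul ((hF f).comp s))).mul
      (((hI _).comp s).mul ((hI _).comp s))).mul
      (((bddFamily_sixCoeff hq1 _ _ _ _).comp Prod.fst).mul
        (((((hF a).comp (fun p : ℕ × ℕ => s p + p.1)).mul ((hF _).comp Prod.snd)).mul
          ((bddFamily_qFin_self_inv hq1).comp Prod.snd)).mul
          ((bddFamily_qFin_inv hq1 hlam).comp (fun p : ℕ × ℕ => s p + p.1 + 1))))
  obtain ⟨C, hC⟩ := hB
  have hgeo : Summable fun p : ℕ × ℕ => C * (‖a * q / (e * f)‖ ^ p.1 * ‖lam * q / (e * f)‖ ^ p.2) :=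
    ((summable_geometric_of_lt_one (norm_nonneg _) hz').mul_of_nonneg
      (summable_geometric_of_lt_one (norm_nonneg _) hz)
      (fun _ => by positivity) (fun _ => by positivity)).mul_left C
  refine Summable.of_norm_bounded hgeo fun p => ?_
  have hpow : a * q / (e * f) = lam * q / (e * f) * (a / lam) := by field_simp
  have key : baileyDouble q a lam b c d e f p = (1 - a * q ^ (2 * s p)) *
      (qFin q e (s p) * qFin q f (s p)) *
      (qPochInf q (a / e * q ^ (s p + 1)) * qPochInf q (a / f * q ^ (s p + 1))) *
      (sixCoeff q (lam * b / a) (lam * c / a) (lam * d / a) (a / (lam * q)) p.1 *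
      (qFin q a (s p + p.1) * qFin q (a / lam) p.2 * (qFin q q p.2)⁻¹ *
        (qFin q lam (s p + p.1 + 1))⁻¹)) *
      ((a * q / (e * f)) ^ p.1 * (lam * q / (e * f)) ^ p.2) := by
    rw [hpow, baileyDouble, pow_add, mul_pow]
    ring
  rw [key, norm_mul]
  rw [norm_mul ((a * q / (e * f)) ^ p.1), norm_pow, norm_pow]
  exact mul_le_mul_of_nonneg_right (hC p) (by positivity)

theorem sum_antidiagonal_baileyDouble {q a lam b c d e f : ℂ} (hq0 : q ≠ 0) (hq1 : ‖q‖ < 1)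
    (ha : a ≠ 0) (hb : b ≠ 0) (hc : c ≠ 0) (hd : d ≠ 0) (hlam0 : lam ≠ 0)
    (hbal : lam * (b * c * d) = q * a ^ 2) (hlam : ∀ j : ℕ, lam * q ^ j ≠ 1) (n : ℕ) :
    ∑ p ∈ Finset.HasAntidiagonal.antidiagonal n, baileyDouble q a lam b c d e f p =
      eightCoeff q a b c d e f n * (lam * q / (e * f)) ^ n := by
  rw [Finset.Nat.sum_antidiagonal_eq_sum_range_succ_mk]
  have h := bailey_expansion hq0 hq1 ha hb hc hd hlam0 hbal hlam n
  calc _ = (1 - a * q ^ (2 * n)) * (qFin q e n * qFin q f n) *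
      (qPochInf q (a / e * q ^ (n + 1)) * qPochInf q (a / f * q ^ (n + 1))) *
      (lam * q / (e * f)) ^ n * ∑ k ∈ Finset.range (n + 1),
        sixCoeff q (lam * b / a) (lam * c / a) (lam * d / a) (a / (lam * q)) k * (a / lam) ^ k *
        (qFin q a (k + (n - k) + k) * qFin q (a / lam) (n - k) * (qFin q q (n - k))⁻¹ *
          (qFin q lam (k + (n - k) + k + 1))⁻¹) := by
        rw [Finset.mul_sum]
        refine Finset.sum_congr rfl fun k hk => ?_
        have hk' : k + (n - k) = n :=
          Nat.add_sub_cancel' (Nat.lt_succ_iff.1 (Finset.mem_range.1 hk))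
        simp only [baileyDouble, hk']
    _ = _ := by
      rw [← h, eightCoeff]
      ring

/-- For fixed `k` the row is a `₆φ₅` with base `a q^(2k)`, upper parameters `e q^k`, `f q^k`, `a/λ`
and argument `λq/(ef)`. -/
theorem tsum_baileyDouble_snd {q a lam b c d e f : ℂ} (hq1 : ‖q‖ < 1)
    (he : e ≠ 0) (hf : f ≠ 0) (ha : a ≠ 0) (hb : b ≠ 0) (hc : c ≠ 0) (hd : d ≠ 0) (hq0 : q ≠ 0)
    (hlam0 : lam ≠ 0) (hbal : lam * (b * c * d) = q * a ^ 2)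
    (hlam : ∀ j : ℕ, lam * q ^ j ≠ 1) (hz : ‖lam * q / (e * f)‖ < 1) (k : ℕ) :
    ∑' r, baileyDouble q a lam b c d e f (k, r) =
      qPochInf q a * qPochInf q (a * q / (e * f)) /
        (qPochInf q lam * qPochInf q (lam * q / (e * f))) *
      (eightCoeff q lam (lam * b / a) (lam * c / a) (lam * d / a) e f k *
        (a * q / (e * f)) ^ k) := by
  have hli : qPochInf q lam ≠ 0 := qPochInf_ne_zero hq1 hlam
  have hl : ∀ j, qFin q lam j ≠ 0 := fun j => qFin_ne_zero fun i _ => hlam i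
  have r1 : e * q ^ k * (f * q ^ k) * (a / lam) * (lam / (e * f)) = a * q ^ (2 * k) := by
    rw [two_mul, pow_add]; field_simp
  have r2 : f * q ^ k * (a / lam) * (lam / (e * f)) = a / e * q ^ k := by field_simp
  have r3 : e * q ^ k * (a / lam) * (lam / (e * f)) = a / f * q ^ k := by field_simp
  have r4 : e * q ^ k * (f * q ^ k) * (lam / (e * f)) = lam * q ^ (2 * k) := by
    rw [two_mul, pow_add]; field_simp
  have r5 : lam / (e * f) * q = lam * q / (e * f) := by ring
  have r6 : a / lam * (lam / (e * f)) * q = a * q / (e * f) := by field_simp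
  have r7 : f * q ^ k * (lam / (e * f)) * q = lam / e * q ^ (k + 1) := by
    rw [pow_succ]; field_simp
  have r8 : e * q ^ k * (lam / (e * f)) * q = lam / f * q ^ (k + 1) := by
    rw [pow_succ]; field_simp
  have term : ∀ r, baileyDouble q a lam b c d e f (k, r) =
      sixCoeff q (lam * b / a) (lam * c / a) (lam * d / a) (a / (lam * q)) k *
        (a * q / (e * f)) ^ k * (qFin q a (2 * k) * qFin q e k * qFin q f k *
        (qPochInf q lam)⁻¹) *
      (sixCoeff q (e * q ^ k) (f * q ^ k) (a / lam) (lam / (e * f)) r *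
        (lam * q / (e * f)) ^ r) := by
    intro r
    have s1 : qPochInf q lam = qFin q lam (k + r + k + 1) *
        qPochInf q (lam * q ^ (2 * k) * q ^ (r + 1)) := by
      rw [qPochInf_eq_qFin_mul hq1 lam (k + r + k + 1), mul_assoc lam, ← pow_add]
      congr 4; omega
    -- The reciprocal of `(λ)_(2k+r+1)` supplies the third infinite product of the `₆φ₅`
    -- coefficient, the one belonging to the parameter `a/λ`.
    have s1' : (qFin q lam (k + r + k + 1))⁻¹ =
        (qPochInf q lam)⁻¹ * qPochInf q (lam * q ^ (2 * k) * q ^ (r + 1)) := by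
      have := hl (k + r + k + 1)
      rw [eq_comm, inv_mul_eq_iff_eq_mul₀ hli, s1]
      field_simp
    have s2 : qFin q a (k + r + k) = qFin q a (2 * k) * qFin q (a * q ^ (2 * k)) r := by
      rw [← qFin_add]; congr 1; omega
    have s3 : ∀ y : ℂ, y * q ^ (k + r + 1) = y * q ^ k * q ^ (r + 1) := fun y => by ring
    have s4 : 1 - a * q ^ (2 * (k + r)) = 1 - a * q ^ (2 * k) * q ^ (2 * r) := by ring
    have s5 : (a * q / (e * f)) ^ k = (lam * q / (e * f)) ^ k * (a / lam) ^ k := by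
      rw [← mul_pow]; congr 1; field_simp
    rw [baileyDouble]
    simp only
    generalize sixCoeff q (lam * b / a) (lam * c / a) (lam * d / a) (a / (lam * q)) k = S
    rw [sixCoeff, r1, r2, r3, r4, s1', s2, s3, s3, s4, s5, qFin_add q e, qFin_add q f, pow_add (lam * q / (e * f))]
    ring
  simp only [term]
  rw [tsum_mul_left, ← r5, tsum_sixCoeff hq1 _ _ _ _ (by rwa [r5]), r1, r5, r6, r7, r8,
    qPochInf_eq_qFin_mul hq1 a (2 * k), eightCoeff, sixCoeff]
  have p1 : lam * b / a * (lam * c / a) * (lam * d / a) * (a / (lam * q)) = lam := by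
    field_simp
    linear_combination hbal
  have p2 : lam * c / a * (lam * d / a) * (a / (lam * q)) = lam / (lam * b / a) := by
    field_simp
    linear_combination hbal
  have p3 : lam * b / a * (lam * d / a) * (a / (lam * q)) = lam / (lam * c / a) := by
    field_simp
    linear_combination hbal
  have p4 : lam * b / a * (lam * c / a) * (a / (lam * q)) = lam / (lam * d / a) := by
    field_simp
    linear_combination hbal
  rw [p1, p2, p3, p4]
  simp only [div_eq_mul_inv (_ * _) (qPochInf q _), div_eq_mul_inv (_ * _) (qPochInf q _ * _),
    mul_inv (qPochInf q lam)]
  ring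

/-- The transformation of a nonterminating very-well-poised `₈φ₇` series. -/
theorem tsum_eightCoeff {q a lam b c d e f : ℂ} (hq0 : q ≠ 0) (hq1 : ‖q‖ < 1)
    (ha : a ≠ 0) (hb : b ≠ 0) (hc : c ≠ 0) (hd : d ≠ 0) (he : e ≠ 0) (hf : f ≠ 0) (hlam0 : lam ≠ 0)
    (hbal : lam * (b * c * d) = q * a ^ 2) (hlam : ∀ j : ℕ, lam * q ^ j ≠ 1)
    (hz : ‖lam * q / (e * f)‖ < 1) (hz' : ‖a * q / (e * f)‖ < 1) :
    ∑' n, eightCoeff q a b c d e f n * (lam * q / (e * f)) ^ n =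
      qPochInf q a * qPochInf q (a * q / (e * f)) /
        (qPochInf q lam * qPochInf q (lam * q / (e * f))) *
      ∑' k, eightCoeff q lam (lam * b / a) (lam * c / a) (lam * d / a) e f k *
        (a * q / (e * f)) ^ k := by
  have hs : Summable (baileyDouble q a lam b c d e f) :=
    summable_baileyDouble hq1 hlam0 hlam hz hz'
  have h1 : ∑' p, baileyDouble q a lam b c d e f p =
      ∑' n, eightCoeff q a b c d e f n * (lam * q / (e * f)) ^ n := by
    rw [← Finset.HasAntidiagonal.sigmaAntidiagonalEquivProd.tsum_eq]
    refine (Summable.tsum_sigma' (fun n => (hasSum_fintype _).summable)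
      ((Finset.HasAntidiagonal.sigmaAntidiagonalEquivProd.summable_iff).2 hs)).trans ?_
    refine tsum_congr fun n => ?_
    rw [← sum_antidiagonal_baileyDouble hq0 hq1 ha hb hc hd hlam0 hbal hlam n, tsum_fintype,
      ← Finset.sum_coe_sort (Finset.HasAntidiagonal.antidiagonal n)]
    rfl
  rw [← h1, hs.tsum_prod, ← tsum_mul_left]
  exact tsum_congr fun k => tsum_baileyDouble_snd hq1 he hf ha hb hc hd hq0 hlam0 hbal hlam hz k

/-! ### Bilateral series with the lower parameter `q^{1+m}` -/

theorem qFin_div_pow (q y : ℂ) (hq0 : q ≠ 0) (m : ℕ) :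
    qFin q (y / q ^ m) m = ∏ j ∈ Finset.range m, (1 - y / q ^ (j + 1)) := by
  rw [qFin, ← Finset.prod_range_reflect]
  refine Finset.prod_congr rfl fun j hj => ?_
  have hj' := Finset.mem_range.1 hj
  have e : q ^ m = q ^ (m - 1 - j) * q ^ (j + 1) := by
    rw [← pow_add]; congr 1; omega
  rw [e]
  field_simp

theorem inv_qPoch_neg_eq_qFin (q y : ℂ) (hq0 : q ≠ 0) (m : ℕ) :
    (qPoch q y (-(m : ℤ)))⁻¹ = qFin q (y / q ^ m) m := by
  rw [inv_qPoch_neg, qFin_div_pow q y hq0]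

theorem qFin_div_pow_ne_zero {q y : ℂ} (hq0 : q ≠ 0) {m : ℕ}
    (h : ∀ j : ℕ, 1 ≤ j → j ≤ m → y ≠ q ^ j) : qFin q (y / q ^ m) m ≠ 0 := by
  rw [qFin_div_pow q y hq0]
  refine Finset.prod_ne_zero_iff.2 fun j hj => sub_ne_zero.2 fun h1 => ?_
  rw [eq_comm, div_eq_one_iff_eq (pow_ne_zero _ hq0)] at h1
  exact h (j + 1) (by omega) (Finset.mem_range.1 hj) h1

theorem qPoch_sub {q y : ℂ} (hq0 : q ≠ 0) {m : ℕ}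
    (h : ∀ j : ℕ, 1 ≤ j → j ≤ m → y ≠ q ^ j) (n : ℕ) :
    qPoch q y ((n : ℤ) - m) = (qFin q (y / q ^ m) m)⁻¹ * qFin q (y / q ^ m) n := by
  have hne := qFin_div_pow_ne_zero hq0 h
  rcases le_total m n with hmn | hmn
  · obtain ⟨t, rfl⟩ := Nat.exists_eq_add_of_le hmn
    rw [qFin_add, div_mul_cancel₀ _ (pow_ne_zero _ hq0), inv_mul_cancel_left₀ hne,
      ← qPoch_natCast]
    congr 1; push_cast; ring
  · obtain ⟨t, rfl⟩ := Nat.exists_eq_add_of_le hmn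
    have e : y / q ^ (n + t) * q ^ n = y / q ^ t := by
      rw [pow_add]; field_simp
    rw [qFin_add, e] at hne ⊢
    rw [show (n : ℤ) - ((n + t : ℕ) : ℤ) = -(t : ℤ) by push_cast; ring,
      ← inv_inj, inv_qPoch_neg_eq_qFin q y hq0]
    have h1 := left_ne_zero_of_mul hne
    field_simp

/-- The reciprocal `1 / (y)_k` has no pole for `k < 0`, so only `(y)_∞ ≠ 0` is needed. -/
theorem inv_qPoch_eq_div {q y : ℂ} (hq0 : q ≠ 0) (hq1 : ‖q‖ < 1)
    (h : ∀ j : ℕ, y * q ^ j ≠ 1) (k : ℤ) :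
    (qPoch q y k)⁻¹ = qPochInf q (y * q ^ k) / qPochInf q y := by
  have hy := qPochInf_ne_zero hq1 h
  obtain ⟨n, rfl | rfl⟩ := k.eq_nat_or_neg
  · have hs := qPochInf_eq_qFin_mul hq1 y n
    rw [hs] at hy ⊢
    have h1 := left_ne_zero_of_mul hy
    have h2 := right_ne_zero_of_mul hy
    rw [qPoch_natCast, zpow_natCast]
    field_simp
  · rw [inv_qPoch_neg_eq_qFin q y hq0, eq_div_iff hy, zpow_neg, zpow_natCast, ← div_eq_mul_inv,
      qPochInf_eq_qFin_mul hq1 (y / q ^ n) n, div_mul_cancel₀ _ (pow_ne_zero _ hq0)]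

/-- Applied to `s` and `-s` with `s² = a`, this produces the very-well-poised factor `(1 - a q^(2k))
/ (1 - a)`. -/
theorem qPoch_mul_left_div {q s : ℂ} (hq0 : q ≠ 0) (hq1 : ‖q‖ < 1) {m : ℕ}
    (hs : ∀ j : ℕ, s * q ^ j ≠ 1) (h : ∀ j : ℕ, 1 ≤ j → j ≤ m → q * s ≠ q ^ j) (n : ℕ) :
    qPoch q (q * s) ((n : ℤ) - m) * (qPoch q s ((n : ℤ) - m))⁻¹ =
      (1 - s * q ^ ((n : ℤ) - m)) / (1 - s) := by
  have hT := qFin_div_pow_ne_zero hq0 h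
  have hI := qPochInf_ne_zero hq1 hs
  have e1 := qPochInf_eq_one_sub_mul hq1 s
  have e2 := qPochInf_eq_one_sub_mul hq1 (s * q ^ ((n : ℤ) - m))
  have e3 := qPochInf_eq_qFin_mul hq1 (q * s / q ^ m) m
  have e4 := qPochInf_eq_qFin_mul hq1 (q * s / q ^ m) n
  have e5 : s * q ^ ((n : ℤ) - m) * q = q * s / q ^ m * q ^ n := by
    rw [zpow_sub₀ hq0, zpow_natCast, zpow_natCast]; ring
  rw [div_mul_cancel₀ _ (pow_ne_zero _ hq0)] at e3
  rw [qPoch_sub hq0 h, inv_qPoch_eq_div hq0 hq1 hs, e2, e5]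
  rw [e1, mul_comm s q] at hI ⊢
  have h1 := left_ne_zero_of_mul hI
  have h2 := right_ne_zero_of_mul hI
  rw [e3] at e4
  generalize qPochInf q (q * s / q ^ m * q ^ n) = X at *
  generalize s * q ^ ((n : ℤ) - m) = u at *
  field_simp
  linear_combination (-(1 - u)) * e4

theorem qPochInf_inv_pow {q : ℂ} (hq0 : q ≠ 0) (hq1 : ‖q‖ < 1) (j : ℕ) :
    qPochInf q ((q ^ j)⁻¹) = 0 := by
  rw [qPochInf_eq_qFin_mul hq1 _ (j + 1), qFin_succ, inv_mul_cancel₀ (pow_ne_zero _ hq0)]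
  simp

/-- The constant relating a very-well-poised bilateral series to a unilateral one. -/
def shiftConst (q z a b c d e f : ℂ) (m : ℕ) : ℂ :=
  (1 - a)⁻¹ * (qFin q (b / q ^ m) m * qFin q (c / q ^ m) m * qFin q (d / q ^ m) m *
    qFin q (e / q ^ m) m * qFin q (a / q ^ m / q ^ m) m * qFin q (f / q ^ m) m)⁻¹ *
    qPochInf q q * (qPochInf q (a * q / b) * qPochInf q (a * q / c) * qPochInf q (a * q / d) *
      qPochInf q (a * q / e) * qPochInf q (q ^ (1 + m)) * qPochInf q (a * q / f))⁻¹ * (z ^ m)⁻¹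

theorem bilateralTerm_sub {q z a s b c d e f : ℂ} (hq0 : q ≠ 0) (hq1 : ‖q‖ < 1) (hz : z ≠ 0)
    {m : ℕ} (hs : s ^ 2 = a)
    (hdef : BilateralDefined m ![q * s, -(q * s), b, c, d, e, a / q ^ m, f]
      ![s, -s, a * q / b, a * q / c, a * q / d, a * q / e, q ^ (1 + m), a * q / f] q) (n : ℕ) :
    bilateralTerm ![q * s, -(q * s), b, c, d, e, a / q ^ m, f]
      ![s, -s, a * q / b, a * q / c, a * q / d, a * q / e, q ^ (1 + m), a * q / f] q z
      ((n : ℤ) - m) = shiftConst q z a b c d e f m *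
        (eightCoeff q (a / q ^ m / q ^ m) (b / q ^ m) (c / q ^ m) (d / q ^ m) (e / q ^ m)
          (f / q ^ m) n * z ^ n) := by
  obtain ⟨hB, hA⟩ := hdef
  have hs1 : 1 - s ≠ 0 := sub_ne_zero.2 fun h => hB 0 0 (by simp [← h])
  have hs2 : 1 - -s ≠ 0 := sub_ne_zero.2 fun h => hB 1 0 (by simp [← h])
  have ha1 : 1 - a = (1 - s) * (1 - -s) := by rw [← hs]; ring
  have w1 := qPoch_mul_left_div (s := s) hq0 hq1 (hB 0) (hA 0) n
  have w2 := qPoch_mul_left_div (s := -s) hq0 hq1 (hB 1)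
    (fun j h1 h2 => by rw [mul_neg]; exact hA 1 j h1 h2) n
  have u : ∀ y, (∀ j : ℕ, 1 ≤ j → j ≤ m → y ≠ q ^ j) → qPoch q y ((n : ℤ) - m) =
      (qFin q (y / q ^ m) m)⁻¹ * qFin q (y / q ^ m) n := fun y hy => qPoch_sub hq0 hy n
  have v : ∀ y, (∀ j : ℕ, a * q / y * q ^ j ≠ 1) → (qPoch q (a * q / y) ((n : ℤ) - m))⁻¹ =
      qPochInf q (a / q ^ m / q ^ m / (y / q ^ m) * q ^ (n + 1)) * (qPochInf q (a * q / y))⁻¹ := by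
    intro y hy
    rw [inv_qPoch_eq_div hq0 hq1 hy, div_eq_mul_inv]
    congr 2
    rw [zpow_sub₀ hq0, zpow_natCast, zpow_natCast]
    field_simp
    ring
  -- Since `q^(1+m) q^(n-m) = q^(n+1)`, this lower parameter yields the `1 / (q)_n` of a unilateral
  -- series.
  have v6 : (qPoch q (q ^ (1 + m)) ((n : ℤ) - m))⁻¹ =
      qPochInf q q * (qFin q q n)⁻¹ * (qPochInf q (q ^ (1 + m)))⁻¹ := by
    have e : q ^ (1 + m) * q ^ ((n : ℤ) - m) = q * q ^ n := by
      rw [zpow_sub₀ hq0, zpow_natCast, zpow_natCast]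
      field_simp
      ring
    have h1 := qFin_self_ne_zero hq1 n
    rw [inv_qPoch_eq_div (y := q ^ (1 + m)) hq0 hq1 (hB 6), e, qPochInf_eq_qFin_mul hq1 q n, div_eq_mul_inv]
    field_simp
  have hz1 : z ^ ((n : ℤ) - m) = z ^ n * (z ^ m)⁻¹ := by
    rw [zpow_sub₀ hz, zpow_natCast, zpow_natCast, div_eq_mul_inv]
  have hquad : (1 - s * q ^ ((n : ℤ) - m)) * (1 - -s * q ^ ((n : ℤ) - m)) =
      1 - a / q ^ m / q ^ m * q ^ (2 * n) := by
    rw [zpow_sub₀ hq0, zpow_natCast, zpow_natCast, ← hs, two_mul, pow_add]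
    field_simp
    ring
  have hprod : bilateralTerm ![q * s, -(q * s), b, c, d, e, a / q ^ m, f]
      ![s, -s, a * q / b, a * q / c, a * q / d, a * q / e, q ^ (1 + m), a * q / f] q z
      ((n : ℤ) - m) =
      (qPoch q (q * s) ((n : ℤ) - m) * (qPoch q s ((n : ℤ) - m))⁻¹) *
      (qPoch q (q * -s) ((n : ℤ) - m) * (qPoch q (-s) ((n : ℤ) - m))⁻¹) *
      (qPoch q b ((n : ℤ) - m) * (qPoch q (a * q / b) ((n : ℤ) - m))⁻¹) *
      (qPoch q c ((n : ℤ) - m) * (qPoch q (a * q / c) ((n : ℤ) - m))⁻¹) *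
      (qPoch q d ((n : ℤ) - m) * (qPoch q (a * q / d) ((n : ℤ) - m))⁻¹) *
      (qPoch q e ((n : ℤ) - m) * (qPoch q (a * q / e) ((n : ℤ) - m))⁻¹) *
      (qPoch q (a / q ^ m) ((n : ℤ) - m) * (qPoch q (q ^ (1 + m)) ((n : ℤ) - m))⁻¹) *
      (qPoch q f ((n : ℤ) - m) * (qPoch q (a * q / f) ((n : ℤ) - m))⁻¹) *
      z ^ ((n : ℤ) - m) := by
    rw [bilateralTerm, Fin.prod_univ_eight, Fin.prod_univ_eight, mul_neg]
    simp only [div_eq_mul_inv (_ * _) (_ * _), mul_inv]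
    simp only [Matrix.cons_val]
    ring
  rw [hprod, w1, w2, u b (hA 2), u c (hA 3), u d (hA 4), u e (hA 5), u (a / q ^ m) (hA 6),
    u f (hA 7), v b (hB 2), v c (hB 3), v d (hB 4), v e (hB 5), v6, v f (hB 7), hz1,
    shiftConst, eightCoeff, ha1, ← hquad]
  simp only [mul_inv, div_eq_mul_inv (1 - _ : ℂ)]
  ring

theorem bilateralTerm_eq_zero {q z a s b c d e f : ℂ} (hq0 : q ≠ 0) (hq1 : ‖q‖ < 1)
    {m : ℕ} {k : ℤ} (hk : k < -(m : ℤ)) :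
    bilateralTerm ![q * s, -(q * s), b, c, d, e, a / q ^ m, f]
      ![s, -s, a * q / b, a * q / c, a * q / d, a * q / e, q ^ (1 + m), a * q / f] q z k = 0 := by
  obtain ⟨j, hj⟩ : ∃ j : ℕ, k = -((m + 1 + j : ℕ) : ℤ) :=
    ⟨(-k - m - 1).toNat, by push_cast; omega⟩
  have h : (qPoch q (q ^ (1 + m)) k)⁻¹ = 0 := by
    have hne : ∀ i : ℕ, q ^ (1 + m) * q ^ i ≠ 1 := fun i => by
      rw [← pow_add, show 1 + m + i = m + i + 1 by omega]
      exact pow_succ_ne_one hq1 _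
    have e : q ^ (1 + m) * q ^ k = (q ^ j)⁻¹ := by
      rw [hj, zpow_neg, zpow_natCast, pow_add q (m + 1) j, add_comm m 1]
      field_simp
    rw [inv_qPoch_eq_div hq0 hq1 hne, e, qPochInf_inv_pow hq0 hq1, zero_div]
  -- At such a pole the Lean value of `(q^(1+m))_k` is itself `0`, so the denominator is `0` and the
  -- quotient is `0` by the division convention.
  rw [inv_eq_zero] at h
  rw [bilateralTerm, Fin.prod_univ_eight (fun i => qPoch q (![s, -s, a * q / b, a * q / c,
    a * q / d, a * q / e, q ^ (1 + m), a * q / f] i) k)]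
  simp [h]

theorem summable_bilateralTerm_and_bilateralPsi {q z a s b c d e f : ℂ} (hq0 : q ≠ 0)
    (hq1 : ‖q‖ < 1) (hz0 : z ≠ 0) (hz : ‖z‖ < 1) {m : ℕ} (hs : s ^ 2 = a)
    (hdef : BilateralDefined m ![q * s, -(q * s), b, c, d, e, a / q ^ m, f]
      ![s, -s, a * q / b, a * q / c, a * q / d, a * q / e, q ^ (1 + m), a * q / f] q) :
    Summable (bilateralTerm ![q * s, -(q * s), b, c, d, e, a / q ^ m, f]
      ![s, -s, a * q / b, a * q / c, a * q / d, a * q / e, q ^ (1 + m), a * q / f] q z) ∧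
    bilateralPsi ![q * s, -(q * s), b, c, d, e, a / q ^ m, f]
      ![s, -s, a * q / b, a * q / c, a * q / d, a * q / e, q ^ (1 + m), a * q / f] q z =
      shiftConst q z a b c d e f m * ∑' n, eightCoeff q (a / q ^ m / q ^ m) (b / q ^ m) (c / q ^ m)
        (d / q ^ m) (e / q ^ m) (f / q ^ m) n * z ^ n := by
  have hinj : Function.Injective fun n : ℕ => (n : ℤ) - m := fun x y h => by
    simpa using h
  have hzero : ∀ k ∉ Set.range (fun n : ℕ => (n : ℤ) - m),
      bilateralTerm ![q * s, -(q * s), b, c, d, e, a / q ^ m, f]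
      ![s, -s, a * q / b, a * q / c, a * q / d, a * q / e, q ^ (1 + m), a * q / f] q z k = 0 := by
    intro k hk
    refine bilateralTerm_eq_zero hq0 hq1 (not_le.1 fun h => hk ⟨(k + m).toNat, ?_⟩)
    simp only
    omega
  have hterm := bilateralTerm_sub hq0 hq1 hz0 hs hdef
  constructor
  · rw [← hinj.summable_iff hzero]
    refine Summable.congr ?_ fun n => (hterm n).symm
    exact ((bddFamily_eightCoeff hq1 _ _ _ _ _ _).summable_mul_pow hz).mul_left _
  · rw [bilateralPsi, ← hinj.tsum_eq fun k hk => by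
      by_contra h
      exact hk (hzero k h)]
    simp only [hterm]
    rw [tsum_mul_left]

/-! ### Matching the prefactors -/

/-- Reversal of a finite `q`-shifted factorial. -/
theorem qFin_div_pow_eq_reverse {q y : ℂ} (hq0 : q ≠ 0) (hy : y ≠ 0) (m : ℕ) :
    qFin q (y / q ^ m) m =
      qFin q (q / y) m * y ^ m * ∏ j ∈ Finset.range m, -(q ^ (j + 1))⁻¹ := by
  have : y ^ m = ∏ _j ∈ Finset.range m, y := by simp
  rw [qFin_div_pow q y hq0, qFin, this, ← Finset.prod_mul_distrib, ← Finset.prod_mul_distrib]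
  refine Finset.prod_congr rfl fun j _ => ?_
  field_simp
  ring

theorem eightCoeff_rotate (q a b c d e f : ℂ) :
    eightCoeff q a b c d e f = eightCoeff q a b c f d e := by
  funext n
  rw [eightCoeff, eightCoeff]
  ring

/-- The coefficients are symmetric in the five parameters, but the transformation separates three of
them from the remaining two, and the bilateral series list them in another order. -/
theorem eightCoeff_swap_blocks (q a b c d e f : ℂ) :
    eightCoeff q a b c d e f = eightCoeff q a d e f b c := by
  funext n
  rw [eightCoeff, eightCoeff]
  ring

/-- Splitting `(a q^(-2m))_∞ = (a q^(-2m))_m (a q^(-m))_m (1 - a) (aq)_∞` cancels two factors of the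
constant; `(a q^(-m))_m` later reverses to `(q/a)_m`. -/
theorem shiftConst_mul_qPochInf {q z a b c d e f : ℂ} (hq0 : q ≠ 0) (hq1 : ‖q‖ < 1)
    (ha1 : 1 - a ≠ 0) {m : ℕ} (hT : qFin q (a / q ^ m / q ^ m) m ≠ 0) :
    shiftConst q z a b c d e f m * qPochInf q (a / q ^ m / q ^ m) =
      qFin q (a / q ^ m) m * qPochInf q (a * q) *
      (qFin q (b / q ^ m) m * qFin q (c / q ^ m) m * qFin q (d / q ^ m) m *
        qFin q (e / q ^ m) m * qFin q (f / q ^ m) m)⁻¹ * qPochInf q q *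
      (qPochInf q (a * q / b) * qPochInf q (a * q / c) * qPochInf q (a * q / d) *
        qPochInf q (a * q / e) * qPochInf q (q ^ (1 + m)) * qPochInf q (a * q / f))⁻¹ *
      (z ^ m)⁻¹ := by
  rw [qPochInf_eq_qFin_mul hq1 (a / q ^ m / q ^ m) m, div_mul_cancel₀ _ (pow_ne_zero _ hq0),
    qPochInf_eq_qFin_mul hq1 (a / q ^ m) m, div_mul_cancel₀ _ (pow_ne_zero _ hq0),
    qPochInf_eq_one_sub_mul hq1 a, shiftConst]
  simp only [mul_inv]
  generalize qFin q (a / q ^ m / q ^ m) m = t at *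
  generalize 1 - a = u at *
  linear_combination (qFin q (a / q ^ m) m * qPochInf q (a * q) *
      ((qFin q (b / q ^ m) m)⁻¹ * (qFin q (c / q ^ m) m)⁻¹ * (qFin q (d / q ^ m) m)⁻¹ *
        (qFin q (e / q ^ m) m)⁻¹ * (qFin q (f / q ^ m) m)⁻¹) * qPochInf q q *
      ((qPochInf q (a * q / b))⁻¹ * (qPochInf q (a * q / c))⁻¹ * (qPochInf q (a * q / d))⁻¹ *
        (qPochInf q (a * q / e))⁻¹ * (qPochInf q (q ^ (1 + m)))⁻¹ * (qPochInf q (a * q / f))⁻¹) *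
      (z ^ m)⁻¹) * (t * t⁻¹ * inv_mul_cancel₀ ha1 + mul_inv_cancel₀ hT)

/-- The final comparison with every factorial replaced by a letter. Here `am = a^m`, `lm = λ^m`, and
`τ` is the power of `-q` common to all reversals. Only factors that must cancel against their own
inverses are assumed nonzero; `am` and `τ` occur to the same net power on both sides. -/
theorem prefactor_identity (w₁ w₅ w₆ w₈ t₁ t₂ r₁ r₂ x i₄ i₅ i₆ i₇ i₈ i₉ j₁ j₂ j₃ j₄ j₅ S : ℂ)
    {am lm τ i₁ i₂ i₃ w₂ w₃ w₄ w₇ : ℂ} (hlm : lm ≠ 0)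
    (hi₁ : i₁ ≠ 0) (hi₂ : i₂ ≠ 0) (hi₃ : i₃ ≠ 0) (hw₂ : w₂ ≠ 0) (hw₃ : w₃ ≠ 0) (hw₄ : w₄ ≠ 0)
    (hw₇ : w₇ ≠ 0) :
    w₁ * am * τ * i₇ * (w₅ * r₁ * τ * (w₆ * r₂ * τ) * t₁ * t₂ * w₈)⁻¹ * j₅ *
        (i₈ * i₉ * j₂ * j₃ * j₄ * j₁)⁻¹ * (x / am)⁻¹ * (i₆ / (i₄ * i₅) * S) =
      i₇ * i₁ * i₂ * i₆ / (i₅ * j₂ * j₃ * i₃) * (w₁ * w₂ * w₃ * w₄ / (w₅ * w₆ * w₇ * w₈)) *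
        (w₇ * lm * τ * i₃ * (t₁ * t₂ * (w₂ * (lm * r₁ / am) * τ) * (w₃ * (lm * r₂ / am) * τ) *
          w₄)⁻¹ * j₅ * (i₁ * i₂ * i₈ * i₉ * j₄ * j₁)⁻¹ * (x / lm)⁻¹ / i₄ * S) := by
  simp only [div_eq_mul_inv, mul_inv, inv_inv]
  calc _ = w₁ * i₇ * w₅⁻¹ * w₆⁻¹ * r₁⁻¹ * r₂⁻¹ * t₁⁻¹ * t₂⁻¹ * w₈⁻¹ * j₅ * i₈⁻¹ * i₉⁻¹ * j₂⁻¹ *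
        j₃⁻¹ * j₄⁻¹ * j₁⁻¹ * x⁻¹ * i₆ * i₄⁻¹ * i₅⁻¹ * S * (am ^ 2 * τ * τ⁻¹ ^ 2) := by ring
    _ = w₁ * i₇ * w₅⁻¹ * w₆⁻¹ * r₁⁻¹ * r₂⁻¹ * t₁⁻¹ * t₂⁻¹ * w₈⁻¹ * j₅ * i₈⁻¹ * i₉⁻¹ * j₂⁻¹ *
        j₃⁻¹ * j₄⁻¹ * j₁⁻¹ * x⁻¹ * i₆ * i₄⁻¹ * i₅⁻¹ * S *
        (am ^ 2 * τ * τ⁻¹ ^ 2 * (i₁ * i₁⁻¹) * (i₂ * i₂⁻¹) * (i₃ * i₃⁻¹) * (w₂ * w₂⁻¹) *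
          (w₃ * w₃⁻¹) * (w₄ * w₄⁻¹) * (w₇ * w₇⁻¹) * (lm * lm⁻¹) ^ 2) := by
      simp only [mul_inv_cancel₀ hi₁, mul_inv_cancel₀ hi₂, mul_inv_cancel₀ hi₃,
        mul_inv_cancel₀ hw₂, mul_inv_cancel₀ hw₃, mul_inv_cancel₀ hw₄, mul_inv_cancel₀ hw₇,
        mul_inv_cancel₀ hlm, one_pow, mul_one]
    _ = _ := by ring

end

/-! ### Transformation of the bilateral series -/

theorem proposition4p1 (q : ℂ) (hq0 : q ≠ 0) (hq1 : ‖q‖ < 1) (m : ℕ)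
    (a α ρ₁ ρ₂ μ₁ μ₂ : ℂ) (ha : a ≠ 0) (hα : α ≠ 0)
    (hρ₁ : ρ₁ ≠ 0) (hρ₂ : ρ₂ ≠ 0) (hμ₁ : μ₁ ≠ 0) (hμ₂ : μ₂ ≠ 0)
    (hconv₁ : ‖α / a‖ < 1) (hconv₂ : ‖a * q / (μ₁ * μ₂)‖ < 1)
    (lam : ℂ) (hlam : lam = α * μ₁ * μ₂ / (a * q))
    -- arbitrary choices of the square roots of `a` and `lam`
    (ra rl : ℂ) (hra : ra ^ 2 = a) (hrl : rl ^ 2 = lam)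
    -- the parameters of the two series
    (A B A' B' : Fin 8 → ℂ)
    (hA : A = ![q * ra, -(q * ra), ρ₁, ρ₂, μ₁, μ₂, a / q ^ m,
      a ^ 3 * q ^ (2 + m) / (α * ρ₁ * ρ₂ * μ₁ * μ₂)])
    (hB : B = ![ra, -ra, a * q / ρ₁, a * q / ρ₂, a * q / μ₁, a * q / μ₂, q ^ (1 + m),
      α * ρ₁ * ρ₂ * μ₁ * μ₂ / q ^ m / (q * a ^ 2)])
    (hA' : A' = ![q * rl, -(q * rl), μ₁, μ₂, lam * ρ₁ / a, lam * ρ₂ / a, lam / q ^ m,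
      a * q ^ (1 + m) / (ρ₁ * ρ₂)])
    (hB' : B' = ![rl, -rl, lam * q / μ₁, lam * q / μ₂, a * q / ρ₁, a * q / ρ₂, q ^ (1 + m),
      lam * ρ₁ * ρ₂ / q ^ m / a])
    -- all terms of the two series are well defined
    (hdef : BilateralDefined m A B q) (hdef' : BilateralDefined m A' B' q)
    -- the factors `(lam * q)_∞` and `(q / lam)_m` in the denominator do not vanish
    -- (for the other factors there this follows from the hypotheses above)
    (hden₁ : ∀ j : ℕ, lam * q ^ (j + 1) ≠ 1)
    (hden₂ : ∀ j : ℕ, 1 ≤ j → j ≤ m → lam ≠ q ^ j) :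
    Summable (bilateralTerm A B q (α / a)) ∧
    Summable (bilateralTerm A' B' q (α / lam)) ∧
    bilateralPsi A B q (α / a) =
      (qPochInf q (a * q) * qPochInf q (lam * q / μ₁) * qPochInf q (lam * q / μ₂)
          * qPochInf q (a * q / (μ₁ * μ₂))) /
        (qPochInf q (α / a) * qPochInf q (a * q / μ₁) * qPochInf q (a * q / μ₂)
          * qPochInf q (lam * q)) *
      ((qPoch q (q / a) m * qPoch q (a * q / (lam * ρ₁)) m * qPoch q (a * q / (lam * ρ₂)) m
          * qPoch q (a * q / (ρ₁ * ρ₂)) m) /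
        (qPoch q (q / ρ₁) m * qPoch q (q / ρ₂) m * qPoch q (q / lam) m
          * qPoch q (q * a ^ 2 / (lam * ρ₁ * ρ₂)) m)) *
      bilateralPsi A' B' q (α / lam) := by
  have hlam0 : lam ≠ 0 := by
    rw [hlam]
    positivity
  have hαlam : α * μ₁ * μ₂ = lam * (a * q) := by
    rw [hlam]
    field_simp
  -- the last upper parameter of the first series, and its image in the second one
  set δ : ℂ := a ^ 2 * q ^ (1 + m) / (lam * ρ₁ * ρ₂) with hδ
  have hδ0 : δ ≠ 0 := by
    rw [hδ]
    positivity
  have eA : a ^ 3 * q ^ (2 + m) / (α * ρ₁ * ρ₂ * μ₁ * μ₂) = δ := by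
    rw [show α * ρ₁ * ρ₂ * μ₁ * μ₂ = (α * μ₁ * μ₂) * (ρ₁ * ρ₂) by ring, hαlam, hδ]
    field_simp
    ring
  have eB : α * ρ₁ * ρ₂ * μ₁ * μ₂ / q ^ m / (q * a ^ 2) = a * q / δ := by
    rw [show α * ρ₁ * ρ₂ * μ₁ * μ₂ = (α * μ₁ * μ₂) * (ρ₁ * ρ₂) by ring, hαlam, hδ, pow_add]
    field_simp
  have eA' : a * q ^ (1 + m) / (ρ₁ * ρ₂) = lam * δ / a := by
    rw [hδ]
    field_simp
  have eB' : lam * ρ₁ * ρ₂ / q ^ m / a = lam * q / (lam * δ / a) := by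
    rw [hδ, pow_add]
    field_simp
  have eρ : ∀ y : ℂ, a * q / y = lam * q / (lam * y / a) := fun y => by
    field_simp
  have hz : α / a = lam * q / (μ₁ * μ₂) := by
    field_simp
    linear_combination hαlam
  have hz' : α / lam = a * q / (μ₁ * μ₂) := by
    field_simp
    linear_combination hαlam
  rw [eA] at hA
  rw [eB] at hB
  rw [eA'] at hA'
  rw [eB', eρ ρ₁, eρ ρ₂] at hB'
  subst hA hB hA' hB'
  obtain ⟨S, P⟩ := summable_bilateralTerm_and_bilateralPsi hq0 hq1 (div_ne_zero hα ha) hconv₁ hra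
    hdef
  obtain ⟨S', P'⟩ := summable_bilateralTerm_and_bilateralPsi hq0 hq1 (div_ne_zero hα hlam0)
    (by rwa [hz']) hrl hdef'
  refine ⟨S, S', ?_⟩
  rw [P, P']
  obtain ⟨hlow, hup⟩ := hdef
  obtain ⟨hlow', hup'⟩ := hdef'
  have one_sub_sq : ∀ s : ℂ, (s * q ^ 0 ≠ 1) → (-s * q ^ 0 ≠ 1) → 1 - s ^ 2 ≠ 0 := by
    intro s h1 h2
    rw [pow_zero, mul_one] at h1 h2
    rw [show 1 - s ^ 2 = (1 - s) * (1 - -s) by ring]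
    exact mul_ne_zero (sub_ne_zero.2 h1.symm) (sub_ne_zero.2 h2.symm)
  have ha1 : 1 - a ≠ 0 := hra ▸ one_sub_sq ra (hlow 0 0) (hlow 1 0)
  have hlam1 : 1 - lam ≠ 0 := hrl ▸ one_sub_sq rl (hlow' 0 0) (hlow' 1 0)
  -- Equality would mean `λ = q^(2m-j)`. Exponents from `1` to `m` are excluded by `hden₂`, those
  -- from `m+1` to `2m` by the upper parameter `λ q^(-m)`, exponent `0` by the lower parameters
  -- `±√λ`, and negative ones by `hden₁`.
  have hlamq : ∀ j : ℕ, lam / q ^ m / q ^ m * q ^ j ≠ 1 := by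
    intro j h
    have h2 : lam * q ^ j = q ^ (2 * m) := by
      rw [two_mul, pow_add]
      field_simp at h
      linear_combination h
    rcases lt_trichotomy j (2 * m) with hj | hj | hj
    · obtain ⟨i, hi⟩ := Nat.exists_eq_add_of_lt hj
      have h3 : lam = q ^ (i + 1) := by
        have hqj : q ^ j ≠ 0 := pow_ne_zero _ hq0
        rw [hi, add_assoc, pow_add q j, mul_comm] at h2
        exact mul_left_cancel₀ hqj h2
      by_cases him : i + 1 ≤ m
      · exact hden₂ (i + 1) (by omega) him h3
      · refine hup' 6 (i + 1 - m) (by omega) (by omega) ?_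
        change lam / q ^ m = q ^ (i + 1 - m)
        rw [div_eq_iff (pow_ne_zero _ hq0), ← pow_add, h3]
        congr 1; omega
    · rw [hj] at h2
      exact hlam1 (by rw [mul_left_eq_self₀.1 h2 |>.resolve_right (pow_ne_zero _ hq0), sub_self])
    · obtain ⟨i, rfl⟩ := Nat.exists_eq_add_of_lt hj
      refine hden₁ i ?_
      rw [add_assoc, pow_add q (2 * m), mul_left_comm] at h2
      exact (mul_eq_left₀ (pow_ne_zero _ hq0)).1 h2
  have hbal : lam / q ^ m / q ^ m * (ρ₁ / q ^ m * (ρ₂ / q ^ m) * (δ / q ^ m)) =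
      q * (a / q ^ m / q ^ m) ^ 2 := by
    rw [hδ, pow_add]
    field_simp
  have hpow : q ^ m ≠ 0 := pow_ne_zero _ hq0
  have g1 : lam / q ^ m / q ^ m * q / (μ₁ / q ^ m * (μ₂ / q ^ m)) = α / a := by
    rw [hz]
    field_simp
  have g2 : a / q ^ m / q ^ m * q / (μ₁ / q ^ m * (μ₂ / q ^ m)) = α / lam := by
    rw [hz']
    field_simp
  have g3 : ∀ y : ℂ, lam / q ^ m / q ^ m * (y / q ^ m) / (a / q ^ m / q ^ m) =
      lam * y / a / q ^ m := fun y => by field_simp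
  have main := tsum_eightCoeff hq0 hq1 (a := a / q ^ m / q ^ m) (lam := lam / q ^ m / q ^ m)
    (b := ρ₁ / q ^ m) (c := ρ₂ / q ^ m) (d := δ / q ^ m) (e := μ₁ / q ^ m) (f := μ₂ / q ^ m)
    (by positivity) (by positivity) (by positivity) (by positivity) (by positivity)
    (by positivity) (by positivity) hbal hlamq (by rwa [g1]) (by rwa [g2, hz'])
  rw [g1, g2, g3, g3, g3] at main
  rw [eightCoeff_rotate q (a / q ^ m / q ^ m),
    eightCoeff_swap_blocks q (lam / q ^ m / q ^ m) (μ₁ / q ^ m), main]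
  generalize ∑' n, eightCoeff q (lam / q ^ m / q ^ m) (lam * ρ₁ / a / q ^ m)
    (lam * ρ₂ / a / q ^ m) (lam * δ / a / q ^ m) (μ₁ / q ^ m) (μ₂ / q ^ m) n * (α / lam) ^ n = S₀
  have hlamI : qPochInf q (lam / q ^ m / q ^ m) ≠ 0 := qPochInf_ne_zero hq1 hlamq
  have K := shiftConst_mul_qPochInf (z := α / a) (b := ρ₁) (c := ρ₂) (d := μ₁) (e := μ₂) (f := δ)
    hq0 hq1 ha1 (qFin_div_pow_ne_zero hq0 (hup 6))
  have K' := shiftConst_mul_qPochInf (z := α / lam) (b := μ₁) (c := μ₂) (d := lam * ρ₁ / a)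
    (e := lam * ρ₂ / a) (f := lam * δ / a) hq0 hq1 hlam1 (qFin_div_pow_ne_zero hq0 (hup' 6))
  rw [← eq_div_iff hlamI] at K'
  rw [← eρ, ← eρ, ← eρ] at K'
  -- The shifted last parameters already have the form that appears in the prefactor, so unlike
  -- those of `a`, `λ` and the `ρ`'s their factorials are not reversed.
  have tδ : δ / q ^ m = q * a ^ 2 / (lam * ρ₁ * ρ₂) := by
    rw [hδ, pow_add]
    field_simp
  have tδ' : lam * δ / a / q ^ m = a * q / (ρ₁ * ρ₂) := by
    rw [hδ, pow_add]
    field_simp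
  have tρ : ∀ y : ℂ, q / (lam * y / a) = a * q / (lam * y) := fun y => by
    field_simp
  have nlam := qFin_div_pow_ne_zero hq0 hden₂
  have nρ₁' := qFin_div_pow_ne_zero hq0 (hup' 4)
  have nρ₂' := qFin_div_pow_ne_zero hq0 (hup' 5)
  have nδ' := qFin_div_pow_ne_zero hq0 (hup' 7)
  have nμ₁ := qPochInf_ne_zero hq1 (hlow' 2)
  have nμ₂ := qPochInf_ne_zero hq1 (hlow' 3)
  have nlamI : qPochInf q (lam * q) ≠ 0 :=
    qPochInf_ne_zero hq1 fun j => by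
      rw [mul_assoc, ← pow_succ']
      exact hden₁ j
  change qFin q (lam * ρ₁ / a / q ^ m) m ≠ 0 at nρ₁'
  change qFin q (lam * ρ₂ / a / q ^ m) m ≠ 0 at nρ₂'
  change qFin q (lam * δ / a / q ^ m) m ≠ 0 at nδ'
  change qPochInf q (lam * q / μ₁) ≠ 0 at nμ₁
  change qPochInf q (lam * q / μ₂) ≠ 0 at nμ₂
  rw [tδ] at K
  rw [tδ'] at nδ' K'
  rw [qFin_div_pow_eq_reverse hq0 hlam0] at nlam
  rw [qFin_div_pow_eq_reverse hq0 (y := lam * ρ₁ / a) (by positivity), tρ] at nρ₁'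
  rw [qFin_div_pow_eq_reverse hq0 (y := lam * ρ₂ / a) (by positivity), tρ] at nρ₂'
  rw [qFin_div_pow_eq_reverse hq0 ha, qFin_div_pow_eq_reverse hq0 hρ₁,
    qFin_div_pow_eq_reverse hq0 hρ₂] at K
  rw [qFin_div_pow_eq_reverse hq0 hlam0,
    qFin_div_pow_eq_reverse hq0 (y := lam * ρ₁ / a) (by positivity),
    qFin_div_pow_eq_reverse hq0 (y := lam * ρ₂ / a) (by positivity), tρ, tρ] at K'
  simp only [qPoch_natCast, ← hz']
  rw [K']
  rw [show ∀ k x y z w s : ℂ, k * (x * y / (z * w) * s) = k * x * (y / (z * w) * s) from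
    fun k x y z w s => by ring, K]
  simp only [div_pow, mul_pow] at nlam nρ₁' nρ₂' ⊢
  exact prefactor_identity _ _ _ _ _ _ _ _ _ _ _ _ _ _ _ _ _ _ _ _ _ (pow_ne_zero m hlam0)
    nμ₁ nμ₂ nlamI (left_ne_zero_of_mul (left_ne_zero_of_mul nρ₁'))
    (left_ne_zero_of_mul (left_ne_zero_of_mul nρ₂')) nδ'
    (left_ne_zero_of_mul (left_ne_zero_of_mul nlam))
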